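/- A constraint graph is a finite undirected multigraph $G=(V,E)$ (loops and parallel edges allowed) with weights $w:E\to\{1,2\}$; edges of weight $1$ are red, edges of weight $2$ are blue, and $E^{\rm red},E^{\rm blue}$ denote the sets of red and of blue edges. An orientation $A$ replaces every edge by one arc with the same end vertices (so a loop has only one orientation); $A^{\rm red},A^{\rm blue}$ are its red and blue arcs and $\rho_B(v)$ is the number of arcs of $B$ entering $v$. $A$ is feasible if $\rho_{A^{\rm red}}(v)+2\rho_{A^{\rm blue}}(v)\ge 2$ for every $v\in V$. Two orientations (of $E$ or of a subset of $E$) are adjacent if they are equal or differ by reversing a single arc, and $A\leftrightsquigarrow A'$ means that there is a sequence of feasible orientations from $A$ to $A'$ in which consecutive members are adjacent. C2E: given a constraint graph $G$, a feasible orientation $A_{\rm ini}$ and an edge $e$, is there a feasible orientation $A$ with $A_{\rm ini}\leftrightsquigarrow A$ in which $e$ has a direction different from its direction in $A_{\rm ini}$? (1) C2E parameterized by the number $k$ of blue edges can be solved in time $2^{O(k)}\cdot{\rm poly}(|V|+|E|)$; the same algorithm runs in time $2^{O(k)}\cdot{\rm poly}(|V|)$ on graphs without parallel edges. Here time is the number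 of steps of a random access machine with addition, truncated subtraction and indirect addressing (each at unit cost), and the input is the list consisting of $|V|$, $|E|$, the index of $e$, and the tail in $A_{\rm ini}$, the head in $A_{\rm ini}$ and the weight of every edge. (2) Let $X$ be the set of vertices incident to a blue edge, and let $\mathcal F$ be the set of pairs $(B,d)$ of an orientation $B$ of $E^{\rm blue}$ and a vector $d\in\{0,1,2\}^X$ such that $2\rho_B(v)+d(v)\ge 2$ for all $v\in X$ and such that some orientation $R$ of $E^{\rm red}$ satisfies $\rho_R(v)=d(v)$ if $v\in X$ and $d(v)\in\{0,1\}$, and $\rho_R(v)\ge 2$ for all other $v\in V$. Two pairs $(B,d),(B',d')\in\mathcal F$ are adjacent if $B=B'$, or if $d=d'$ and $B,B'$ are adjacent. If $e$ is blue, then the answer to C2E is yes if and only if some $(B,d)\in\mathcal F$ in which $e$ has a direction different from its direction in $A_{\rm ini}$ can be reached, by a sequence in $\mathcal F$ whose consecutive members are adjacent, from $\bigl(A_{\rm ini}^{\rm blue},\,(\min\{\rho_{A_{\rm ini}^{\rm red}}(v),2\})_{v\in X}\bigr)$. (3) If $e$ is red and not a loop, and $u$ is its head in $A_{\rm ini}$,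 then the answer to C2E is yes if and only if Problem A has a solution for $(G,A_{\rm ini},u)$, that is, there is a feasible orientation $A$ with $A_{\rm ini}\leftrightsquigarrow A$ and $2\rho_{A^{\rm blue}}(u)+\rho_{A^{\rm red}}(u)\ge 3$. -/

import Mathlib

/-! ### Orientations of undirected multigraphs (loops and parallel edges allowed) -/

/-- An orientation of a family of undirected edges `ends : E → Sym2 V`: every edge is replaced by
one arc `(tail, head)` with the same two end vertices.  A loop has exactly one orientation. -/
@[ext] structure EdgeOrientation {V E : Type*} (ends : E → Sym2 V) where
  arc : E → V × V
  ends_eq : ∀ e, s((arc e).1, (arc e).2) = ends e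

namespace EdgeOrientation

variable {V E : Type*} {ends : E → Sym2 V}

/-- The vertex that the arc of `e` leaves. -/
def tail (B : EdgeOrientation ends) (e : E) : V := (B.arc e).1

/-- The vertex that the arc of `e` enters. -/
def head (B : EdgeOrientation ends) (e : E) : V := (B.arc e).2

/-- The number of arcs entering `v`. -/
def indeg [Fintype E] [DecidableEq V] (B : EdgeOrientation ends) (v : V) : ℕ :=
  (Finset.univ.filter fun e => B.head e = v).card

/-- `B ↔ B'`: the two orientations are equal, or `B'` arises by reversing a single arc of `B`. -/
def Adj (B B' : EdgeOrientation ends) : Prop :=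
  B = B' ∨ ∃ e, B'.arc e = (B.arc e).swap ∧ ∀ f, f ≠ e → B'.arc f = B.arc f

end EdgeOrientation

/-! ### Constraint graphs, configurations, reconfiguration -/

/-- A constraint graph: an undirected multigraph whose edges have weight one (red) or
two (blue). -/
structure ConstraintGraph (V E : Type*) where
  ends : E → Sym2 V
  weight : E → ℕ
  weight_eq : ∀ e, weight e = 1 ∨ weight e = 2

namespace ConstraintGraph

variable {V E : Type*}

abbrev RedEdge (G : ConstraintGraph V E) : Type _ := {e : E // G.weight e = 1}

abbrev BlueEdge (G : ConstraintGraph V E) : Type _ := {e : E // G.weight e = 2}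

/-- The number of blue edges. -/
def numBlue [Fintype E] (G : ConstraintGraph V E) : ℕ := Fintype.card G.BlueEdge

/-- No two distinct edges have the same end vertices. -/
def NoParallelEdges (G : ConstraintGraph V E) : Prop := Function.Injective G.ends

/-- Orientations of the whole edge set. -/
abbrev Ori (G : ConstraintGraph V E) : Type _ := EdgeOrientation G.ends

/-- Orientations of the set of red edges. -/
abbrev RedOri (G : ConstraintGraph V E) : Type _ := EdgeOrientation fun e : G.RedEdge => G.ends e

/-- Orientations of the set of blue edges. -/
abbrev BlueOri (G : ConstraintGraph V E) : Type _ := EdgeOrientation fun e : G.BlueEdge => G.ends e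

variable {G : ConstraintGraph V E}

/-- The red arcs of an orientation. -/
def Ori.red (A : G.Ori) : G.RedOri := ⟨fun e => A.arc e, fun e => A.ends_eq e⟩

/-- The blue arcs of an orientation. -/
def Ori.blue (A : G.Ori) : G.BlueOri := ⟨fun e => A.arc e, fun e => A.ends_eq e⟩

variable [Fintype E] [DecidableEq V]

/-- The total weight of the arcs entering `v`. -/
def Ori.inWeight (A : G.Ori) (v : V) : ℕ :=
  (Ori.red A).indeg v + 2 * (Ori.blue A).indeg v

/-- Feasible orientations (configurations): the in-weight of every vertex is at least two. -/
def Ori.Feasible (A : G.Ori) : Prop := ∀ v, 2 ≤ Ori.inWeight A v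

/-- There is a sequence of feasible orientations from `A` to `A'` in which consecutive members
are adjacent. -/
def Ori.Reaches (A A' : G.Ori) : Prop :=
  Ori.Feasible A ∧ Relation.ReflTransGen (fun B B' : G.Ori => Ori.Feasible B' ∧ B.Adj B') A A'

/-- The question C2E: can a configuration be reached from `A` in which the direction of `e`
differs from its direction in `A`? -/
def C2E (A : G.Ori) (e : E) : Prop := ∃ A' : G.Ori, Ori.Reaches A A' ∧ A'.arc e ≠ A.arc e

/-- `A'` is a solution of Problem A for the input `A`, `u`. -/
def IsProblemASolution (A : G.Ori) (u : V) (A' : G.Ori) : Prop :=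
  Ori.Reaches A A' ∧ 3 ≤ Ori.inWeight A' u

/-! ### The classes of configurations -/

/-- The vertices incident to a blue edge. -/
def X (G : ConstraintGraph V E) : Set V := {v | ∃ e : G.BlueEdge, v ∈ G.ends e}

/-- Pairs `(B, d)` of an orientation of the blue edges and a vector `d ∈ {0, 1, 2}^X`. -/
abbrev ClassPair (G : ConstraintGraph V E) : Type _ := G.BlueOri × (G.X → Fin 3)

/-- The orientation `R` of the red edges realizes the vector `d`. -/
def Realizes (R : G.RedOri) (d : G.X → Fin 3) : Prop :=
  (∀ v : G.X, (d v = 0 → R.indeg v = 0) ∧ (d v = 1 → R.indeg v = 1) ∧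
    (d v = 2 → 2 ≤ R.indeg v)) ∧
  ∀ v : V, v ∉ G.X → 2 ≤ R.indeg v

/-- Membership of a pair in the set of classes. -/
def ClassPair.IsClass (c : G.ClassPair) : Prop :=
  (∀ v : G.X, 2 ≤ 2 * c.1.indeg v + (c.2 v : ℕ)) ∧ ∃ R : G.RedOri, Realizes R c.2

/-- Adjacency of classes. -/
def ClassPair.Adj (c c' : G.ClassPair) : Prop := (c.2 = c'.2 ∧ c.1.Adj c'.1) ∨ c.1 = c'.1

/-- Reachability among the classes. -/
def ClassPair.Reaches (c c' : G.ClassPair) : Prop :=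
  ClassPair.IsClass c ∧
    Relation.ReflTransGen
      (fun b b' : G.ClassPair => ClassPair.IsClass b' ∧ ClassPair.Adj b b') c c'

/-- The class of a configuration. -/
def Ori.classOf (A : G.Ori) : G.ClassPair :=
  (Ori.blue A, fun v => ⟨min ((Ori.red A).indeg v) 2, by omega⟩)

end ConstraintGraph

/-! ### Random access machines

Structured programs for a random access machine with registers `R` and a memory `M`, both holding
natural numbers.  Every elementary instruction and every test costs one step.  The only arithmetic
is addition and truncated subtraction, so that this step count is polynomially related to the
running time of Turing machines. -/

namespace RAM

inductive Prog where
  /-- `R x := c` -/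
  | const (x c : ℕ)
  /-- `R x := R y` -/
  | copy (x y : ℕ)
  /-- `R x := R y + R z` -/
  | add (x y z : ℕ)
  /-- `R x := R y - R z`, truncated at zero -/
  | sub (x y z : ℕ)
  /-- `R x := M (R y)` -/
  | load (x y : ℕ)
  /-- `M (R x) := R y` -/
  | store (x y : ℕ)
  /-- first `p`, then `q` -/
  | seq (p q : Prog)
  /-- if `R x ≠ 0` then `p` else `q` -/
  | cond (x : ℕ) (p q : Prog)
  /-- while `R x ≠ 0` do `p` -/
  | loop (x : ℕ) (p : Prog)

structure State where
  reg : ℕ → ℕ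
  mem : ℕ → ℕ

/-- `Run p s t s'`: started in state `s`, the program `p` halts after exactly `t` steps, in
state `s'`. -/
inductive Run : Prog → State → ℕ → State → Prop
  | const (x c : ℕ) (s : State) :
      Run (.const x c) s 1 { s with reg := Function.update s.reg x c }
  | copy (x y : ℕ) (s : State) :
      Run (.copy x y) s 1 { s with reg := Function.update s.reg x (s.reg y) }
  | add (x y z : ℕ) (s : State) :
      Run (.add x y z) s 1 { s with reg := Function.update s.reg x (s.reg y + s.reg z) }
  | sub (x y z : ℕ) (s : State) :
      Run (.sub x y z) s 1 { s with reg := Function.update s.reg x (s.reg y - s.reg z) }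
  | load (x y : ℕ) (s : State) :
      Run (.load x y) s 1 { s with reg := Function.update s.reg x (s.mem (s.reg y)) }
  | store (x y : ℕ) (s : State) :
      Run (.store x y) s 1 { s with mem := Function.update s.mem (s.reg x) (s.reg y) }
  | seq {p q : Prog} {s s' s'' : State} {t t' : ℕ} :
      Run p s t s' → Run q s' t' s'' → Run (.seq p q) s (t + t') s''
  | cond_true {x : ℕ} {p q : Prog} {s s' : State} {t : ℕ} :
      s.reg x ≠ 0 → Run p s t s' → Run (.cond x p q) s (t + 1) s'
  | cond_false {x : ℕ} {p q : Prog} {s s' : State} {t : ℕ} :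
      s.reg x = 0 → Run q s t s' → Run (.cond x p q) s (t + 1) s'
  | loop_exit {x : ℕ} {p : Prog} {s : State} :
      s.reg x = 0 → Run (.loop x p) s 1 s
  | loop_next {x : ℕ} {p : Prog} {s s' s'' : State} {t t' : ℕ} :
      s.reg x ≠ 0 → Run p s t s' → Run (.loop x p) s' t' s'' →
        Run (.loop x p) s (t + t' + 1) s''

/-- The initial state for an input word `l`: the word is in the memory cells `0, 1, …`, and all
other cells and all registers are zero. -/
def init (l : List ℕ) : State := ⟨fun _ => 0, fun i => l.getD i 0⟩

end RAM

/-! ### Instances of C2E as inputs -/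

/-- An instance of C2E: a constraint graph on the vertices `0, …, n - 1` with edges
`0, …, m - 1`, a feasible orientation, and an edge. -/
structure C2EInstance where
  n : ℕ
  m : ℕ
  G : ConstraintGraph (Fin n) (Fin m)
  A : G.Ori
  feasible : ConstraintGraph.Ori.Feasible A
  e : Fin m

/-- The input word: the number of vertices, the number of edges and the name of the edge to
reverse, followed by tail, head and weight of every edge. -/
def C2EInstance.encode (I : C2EInstance) : List ℕ :=
  [I.n, I.m, (I.e : ℕ)] ++
    (List.finRange I.m).flatMap fun f =>
      [(I.A.tail f : ℕ), (I.A.head f : ℕ), I.G.weight f]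

/-- The answer to the instance is yes. -/
def C2EInstance.Yes (I : C2EInstance) : Prop := ConstraintGraph.C2E I.A I.e

/-! ### Weighted in-degrees and reversals of single arcs -/

namespace EdgeOrientation

set_option linter.unusedSectionVars false

section Flow

variable {V E : Type*} {ends : E → Sym2 V}

/-! The core is a rearrangement principle, `exists_reaches_inflow_eq`. Let `A` and `B` be feasible
and agree on a set `S` outside which all weights are one. As long as some arc on which they disagree
enters, in `A`, a vertex of in-weight above two, reversing it keeps feasibility and lowers the
number of disagreements. When no such arc is left, the in-weights of `A` are at most those of `B`
everywhere, and both have the same total, so they coincide. Hence the directions on `S` alone decide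
which in-weights can be reached without touching `S`.

For the algorithm, `S` consists of the blue edges and the given edge, so the directions on `S` form
a code of at most `k + 1` bits. A bit can be reversed exactly when the directions on `S` extend to
an orientation that supplies every vertex even without the edge `j` of that bit (`Free`).
Sufficiency is `CodeReached.toggle`: rearrange to the in-weights of such an extension, then reverse
`j`. Necessity is part of `exists_code_of_reaches`: if both directions of a non-loop are feasible,
then at every vertex one of the two shows that the other edges suffice. So C2E becomes reachability
on at most `2 ^ (k + 1)` codes.

`Free` is decided by a push-relabel procedure. Each push moves a unit of inflow to a deficient
vertex, and the sum of inflow times label grows by at least one (`PushInv.step`), while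
completability keeps it below `2 |V|²` (`PushInv.decides`). Impossibility is certified by a closed
set with too little inflow (`not_completable_of_closed`).

The procedure is written in a small language with bounded loops, whose compiler to the random access
machine is verified together with a static cost bound (`Cmd.run_compile`, `Cmd.cost_le`). Every loop
limit is at most `timeBase`, that is `2 ^ k` times a linear term, so a fixed power of it bounds the
running time.

The class criterion uses the same principle with `S` the set of blue edges: configurations project
to classes, and each step between classes lifts back (`ClassPair.Reaches.exists_ori`). The statement
on red edges looks at the first reversal of the edge: just before it, the head must have in-weight
at least three. -/

theorem arc_eq_or_swap (B B' : EdgeOrientation ends) (e : E) :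
    B'.arc e = B.arc e ∨ B'.arc e = (B.arc e).swap := by
  have h := (B'.ends_eq e).trans (B.ends_eq e).symm
  rw [Sym2.eq_iff] at h
  rcases h with h | h
  · exact Or.inl (Prod.ext h.1 h.2)
  · exact Or.inr (Prod.ext h.1 h.2)

variable [DecidableEq E]

/-- Reverse the arc of `e`. -/
def flip (B : EdgeOrientation ends) (e : E) : EdgeOrientation ends where
  arc := Function.update B.arc e (B.arc e).swap
  ends_eq f := by
    by_cases h : f = e
    · subst h
      simpa [Sym2.eq_swap] using B.ends_eq f
    · simpa [Function.update_of_ne h] using B.ends_eq f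

theorem flip_arc_self (B : EdgeOrientation ends) (e : E) : (B.flip e).arc e = (B.arc e).swap := by
  simp [flip]

theorem flip_arc_of_ne (B : EdgeOrientation ends) {e f : E} (h : f ≠ e) :
    (B.flip e).arc f = B.arc f := by
  simp [flip, h]

theorem adj_flip (B : EdgeOrientation ends) (e : E) : B.Adj (B.flip e) :=
  Or.inr ⟨e, flip_arc_self B e, fun _ h => flip_arc_of_ne B h⟩

theorem eq_flip {B B' : EdgeOrientation ends} {e : E} (h : B'.arc e = (B.arc e).swap)
    (h' : ∀ f, f ≠ e → B'.arc f = B.arc f) : B' = B.flip e := by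
  ext1
  funext f
  by_cases hf : f = e
  · subst hf
    rw [h, flip_arc_self]
  · rw [h' f hf, flip_arc_of_ne B hf]

theorem flip_eq_self_of_loop {B : EdgeOrientation ends} {e : E} (h : B.tail e = B.head e) :
    B.flip e = B := by
  refine (eq_flip (Prod.ext ?_ ?_) fun _ _ => rfl).symm
  · exact h
  · exact h.symm

variable [Fintype E] [DecidableEq V]

/-- The total weight of the arcs entering `v`. -/
def inflow (w : E → ℕ) (B : EdgeOrientation ends) (v : V) : ℕ :=
  ∑ e, if B.head e = v then w e else 0

theorem inflow_flip (w : E → ℕ) (B : EdgeOrientation ends) (e : E) (v : V) :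
    inflow w (B.flip e) v + (if B.head e = v then w e else 0) =
      inflow w B v + (if B.tail e = v then w e else 0) := by
  unfold inflow
  rw [← Finset.add_sum_erase _ _ (Finset.mem_univ e),
    ← Finset.add_sum_erase Finset.univ (fun f => if B.head f = v then w f else 0)
      (Finset.mem_univ e)]
  have h1 : (B.flip e).head e = B.tail e := by simp [head, tail, flip_arc_self]
  have h2 : ∑ f ∈ Finset.univ.erase e, (if (B.flip e).head f = v then w f else 0) =
      ∑ f ∈ Finset.univ.erase e, if B.head f = v then w f else 0 := by
    refine Finset.sum_congr rfl fun f hf => ?_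
    have : (B.flip e).head f = B.head f := by
      simp [head, flip_arc_of_ne B (Finset.ne_of_mem_erase hf)]
    rw [this]
  rw [h1, h2]
  ring

/-- The contribution of the edge `j` to the inflow. -/
theorem inflow_eq_add (w : E → ℕ) (j : E) (B : EdgeOrientation ends) (v : V) :
    inflow w B v =
      inflow (Function.update w j 0) B v + if B.head j = v then w j else 0 := by
  unfold inflow
  rw [← Finset.add_sum_erase _ _ (Finset.mem_univ j),
    ← Finset.add_sum_erase Finset.univ (fun f => if B.head f = v then _ else 0)
      (Finset.mem_univ j)]
  have h2 : ∑ f ∈ Finset.univ.erase j, (if B.head f = v then Function.update w j 0 f else 0) =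
      ∑ f ∈ Finset.univ.erase j, if B.head f = v then w f else 0 := by
    refine Finset.sum_congr rfl fun f hf => ?_
    rw [Function.update_of_ne (Finset.ne_of_mem_erase hf)]
  rw [h2]
  simp
  ring

theorem inflow_update_flip (w : E → ℕ) (j : E) (B : EdgeOrientation ends) (v : V) :
    inflow (Function.update w j 0) (B.flip j) v = inflow (Function.update w j 0) B v := by
  have := inflow_flip (Function.update w j 0) B j v
  simpa using this

theorem sum_inflow (w : E → ℕ) (B : EdgeOrientation ends) (U : Finset V) :
    ∑ v ∈ U, inflow w B v = ∑ e, if B.head e ∈ U then w e else 0 := by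
  unfold inflow
  rw [Finset.sum_comm]
  refine Finset.sum_congr rfl fun e _ => ?_
  rw [Finset.sum_ite_eq]

variable [Fintype V]

/-- Two feasible orientations that agree on `S`, all other edges having weight one: from the first
one can reach an orientation with the same inflows as the second, without touching `S`. -/
theorem exists_reaches_inflow_eq (w : E → ℕ) (S : Set E) (hS : ∀ f, f ∉ S → w f = 1)
    {B : EdgeOrientation ends} (hB : ∀ v, 2 ≤ inflow w B v) :
    ∀ A : EdgeOrientation ends, (∀ v, 2 ≤ inflow w A v) → (∀ f ∈ S, B.arc f = A.arc f) →
    ∃ C : EdgeOrientation ends,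
      Relation.ReflTransGen (fun D D' => (∀ v, 2 ≤ inflow w D' v) ∧ D.Adj D') A C ∧
      (∀ f ∈ S, C.arc f = A.arc f) ∧ ∀ v, inflow w C v = inflow w B v := by
  intro A
  induction hk : (Finset.univ.filter fun f => A.arc f ≠ B.arc f).card using Nat.strong_induction_on
    generalizing A with
  | _ k ih =>
    intro hA hAB
    -- Reversing such an arc costs its head one unit of a surplus and removes one disagreement with
    -- `B`.
    by_cases hex : ∃ f, A.arc f ≠ B.arc f ∧ 2 < inflow w A (A.head f)
    · obtain ⟨f, hf, hf2⟩ := hex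
      have hfS : f ∉ S := fun h => hf (hAB f h).symm
      have hBf : B.arc f = (A.arc f).swap :=
        (arc_eq_or_swap A B f).resolve_left (fun h => hf h.symm)
      have hfeas : ∀ v, 2 ≤ inflow w (A.flip f) v := by
        intro v
        have h := inflow_flip w A f v
        have := hA v
        rw [hS f hfS] at h
        by_cases hv : A.head f = v
        · subst hv
          simp only [if_true] at h
          omega
        · simp only [hv, if_false] at h
          omega
      have hS' : ∀ g ∈ S, (A.flip f).arc g = A.arc g := fun g hg =>
        flip_arc_of_ne A (fun h => hfS (h ▸ hg))
      have hlt : (Finset.univ.filter fun g => (A.flip f).arc g ≠ B.arc g).card < k := by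
        rw [← hk]
        refine Finset.card_lt_card ?_
        rw [Finset.ssubset_iff_of_subset]
        · refine ⟨f, by simpa using hf, by simp [flip_arc_self, hBf]⟩
        · intro g
          simp only [Finset.mem_filter, Finset.mem_univ, true_and]
          intro hg
          by_cases hgf : g = f
          · subst hgf
            exact hf
          · rwa [flip_arc_of_ne A hgf] at hg
      obtain ⟨C, hC, hCS, hCB⟩ := ih _ hlt (A.flip f) rfl hfeas
        (fun g hg => (hAB g hg).trans (hS' g hg).symm)
      exact ⟨C, Relation.ReflTransGen.head ⟨hfeas, adj_flip A f⟩ hC,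
        fun g hg => (hCS g hg).trans (hS' g hg), hCB⟩
    · push Not at hex
      refine ⟨A, Relation.ReflTransGen.refl, fun _ _ => rfl, ?_⟩
      -- A vertex entered by a disagreeing arc has inflow at most two in `A`. At any other vertex
      -- all arcs of `A` entering it are arcs of `B` too. Equality then follows because both totals
      -- are the total weight.
      have hle : ∀ v ∈ Finset.univ, inflow w A v ≤ inflow w B v := by
        intro v _
        by_cases hv : ∃ f, A.arc f ≠ B.arc f ∧ A.head f = v
        · obtain ⟨f, hf, rfl⟩ := hv
          exact (hex f hf).trans (hB _)
        · push Not at hv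
          refine Finset.sum_le_sum fun f _ => ?_
          by_cases hfv : A.head f = v
          · have : A.arc f = B.arc f := by
              by_contra h
              exact hv f h hfv
            have : B.head f = v := by rw [← hfv, head, head, this]
            simp [this, hfv]
          · simp [hfv]
      have hsum : ∑ v, inflow w A v = ∑ v, inflow w B v := by
        rw [sum_inflow, sum_inflow]
        simp
      exact fun v => (Finset.sum_eq_sum_iff_of_le hle).1 hsum v (Finset.mem_univ v)

/-! ### Deciding feasibility by pushing deficits along a valid labelling -/

/-- Some orientation that agrees with `B` on `S` has inflow at least two everywhere. -/
def Completable (w : E → ℕ) (S : Set E) (B : EdgeOrientation ends) : Prop :=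
  ∃ C : EdgeOrientation ends, (∀ f ∈ S, C.arc f = B.arc f) ∧ ∀ v, 2 ≤ inflow w C v

/-- No free arc of `B` leaves `U`, so `B` already directs into `U` every edge that any orientation
agreeing with it on `S` could direct there. The total inflow of `U` is thus maximal for `B`, yet it
is below `2 |U|`. -/
theorem not_completable_of_closed {w : E → ℕ} {S : Set E} {B : EdgeOrientation ends}
    (U : Finset V) (hU : ∀ f, f ∉ S → B.tail f ∈ U → B.head f ∈ U)
    (hle : ∀ u ∈ U, inflow w B u ≤ 2) {v : V} (hv : v ∈ U) (hlt : inflow w B v < 2) :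
    ¬ Completable w S B := by
  rintro ⟨C, hCS, hC⟩
  have h1 : ∑ u ∈ U, inflow w C u ≤ ∑ u ∈ U, inflow w B u := by
    rw [sum_inflow, sum_inflow]
    refine Finset.sum_le_sum fun f _ => ?_
    by_cases hf : C.head f ∈ U
    · have : B.head f ∈ U := by
        by_cases hfS : f ∈ S
        · have := hCS f hfS
          rwa [head, this] at hf
        · rcases arc_eq_or_swap B C f with h | h
          · rwa [head, h] at hf
          · refine hU f hfS ?_
            rwa [head, h] at hf
      simp [hf, this]
    · simp [hf]
  have h2 : ∑ u ∈ U, inflow w B u < ∑ u ∈ U, inflow w C u :=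
    Finset.sum_lt_sum (fun u hu => (hle u hu).trans (hC u)) ⟨v, hv, hlt.trans_le (hC v)⟩
  omega

/-- Labels that bound from below the distance to a vertex with surplus. -/
structure ValidLabel (w : E → ℕ) (S : Set E) (B : EdgeOrientation ends) (h : V → ℕ) : Prop where
  arc_le : ∀ f, f ∉ S → h (B.tail f) ≤ h (B.head f) + 1
  surplus : ∀ v, 2 < inflow w B v → h v = 0

/-- A gap argument: if a deficient vertex had a label of at least `|V|`, some smaller label would be
unused. Labels drop by at most one along free arcs, so the vertices above the gap are closed. They
have no surplus, because surplus forces label zero. -/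
theorem ValidLabel.lt_card {w : E → ℕ} {S : Set E} {B : EdgeOrientation ends} {h : V → ℕ}
    (hval : ValidLabel w S B h) (hcomp : Completable w S B) {v : V} (hv : inflow w B v < 2) :
    h v < Fintype.card V := by
  by_contra hge
  push Not at hge
  have hcard : ((Finset.univ.erase v).image h).card < (Finset.range (Fintype.card V)).card := by
    refine Finset.card_image_le.trans_lt ?_
    rw [Finset.card_erase_of_mem (Finset.mem_univ v), Finset.card_range, Finset.card_univ]
    have : 0 < Fintype.card V := Fintype.card_pos_iff.2 ⟨v⟩
    omega
  -- Pigeonhole: the vertices other than `v` take at most `|V| - 1` of the `|V|` labels below `|V|`,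
  -- and `v` takes none of them.
  obtain ⟨l, hl, hl'⟩ := Finset.exists_mem_notMem_of_card_lt_card hcard
  rw [Finset.mem_range] at hl
  have hne : ∀ u, h u ≠ l := by
    intro u hu
    by_cases huv : u = v
    · subst huv
      omega
    · exact hl' (Finset.mem_image.2 ⟨u, Finset.mem_erase.2 ⟨huv, Finset.mem_univ u⟩, hu⟩)
  refine not_completable_of_closed (Finset.univ.filter fun u => l < h u) ?_ ?_ (v := v) ?_ hv hcomp
  · intro f hf ht
    simp only [Finset.mem_filter, Finset.mem_univ, true_and] at ht ⊢
    have := hval.arc_le f hf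
    have := hne (B.head f)
    omega
  · intro u hu
    simp only [Finset.mem_filter, Finset.mem_univ, true_and] at hu
    by_contra hlt
    have := hval.surplus u (by omega)
    omega
  · simp only [Finset.mem_filter, Finset.mem_univ, true_and]
    omega

theorem Completable.congr {w : E → ℕ} {S : Set E} {B B' : EdgeOrientation ends}
    (h : ∀ f ∈ S, B'.arc f = B.arc f) : Completable w S B ↔ Completable w S B' :=
  ⟨fun ⟨C, hC, hC'⟩ => ⟨C, fun f hf => (hC f hf).trans (h f hf).symm, hC'⟩,
    fun ⟨C, hC, hC'⟩ => ⟨C, fun f hf => (hC f hf).trans (h f hf), hC'⟩⟩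

/-- A push: `f` can be reversed to reduce the deficit of its tail. -/
def CanPush (w : E → ℕ) (S : Set E) (B : EdgeOrientation ends) (f : E) : Prop :=
  f ∉ S ∧ B.tail f ≠ B.head f ∧ inflow w B (B.tail f) < 2

/-- One step of the algorithm: push along an arc with lowest head, if there is one. -/
inductive PushStep (w : E → ℕ) (S : Set E) :
    EdgeOrientation ends → (V → ℕ) → EdgeOrientation ends → (V → ℕ) → Prop
  | idle {B h} (hno : ∀ f, ¬ CanPush w S B f) : PushStep w S B h B h
  | push {B h} {f : E} (hf : CanPush w S B f)
      (hmin : ∀ g, CanPush w S B g → h (B.head f) ≤ h (B.head g)) :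
      PushStep w S B h (B.flip f) (Function.update h (B.tail f) (h (B.head f) + 1))

/-- The invariant after `i` steps that started from `B₀`. -/
structure PushInv (w : E → ℕ) (S : Set E) (B₀ : EdgeOrientation ends) (i : ℕ)
    (B : EdgeOrientation ends) (h : V → ℕ) : Prop where
  agree : ∀ f ∈ S, B.arc f = B₀.arc f
  valid : ValidLabel w S B h
  lt_card : Completable w S B₀ → ∀ v, h v < Fintype.card V
  progress : Completable w S B₀ → (∀ v, 2 ≤ inflow w B v) ∨ i ≤ ∑ v, inflow w B v * h v

theorem PushInv.init {w : E → ℕ} {S : Set E} {B₀ : EdgeOrientation ends} :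
    PushInv w S B₀ 0 B₀ fun _ => 0 :=
  ⟨fun _ _ => rfl, ⟨fun _ _ => Nat.zero_le _, fun _ _ => rfl⟩,
    fun _ v => Fintype.card_pos_iff.2 ⟨v⟩, fun _ => Or.inr (Nat.zero_le _)⟩

/-- An idle step means that a deficient vertex would have no free non-loop arc leaving it, so its
singleton would be a closed set. A push moves one unit from the head, with label `h`, to the tail,
with new label `h + 1`; labels never decrease, so the potential grows. -/
theorem PushInv.step {w : E → ℕ} {S : Set E} (hS : ∀ f, f ∉ S → w f = 1)
    {B₀ B B' : EdgeOrientation ends} {h h' : V → ℕ} {i : ℕ} (hinv : PushInv w S B₀ i B h)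
    (hstep : PushStep w S B h B' h') : PushInv w S B₀ (i + 1) B' h' := by
  cases hstep with
  | idle hno =>
    refine ⟨hinv.agree, hinv.valid, hinv.lt_card, fun hc => Or.inl ?_⟩
    by_contra hdef
    push Not at hdef
    obtain ⟨v, hv⟩ := hdef
    refine not_completable_of_closed (B := B) {v} ?_ ?_ (Finset.mem_singleton_self v) hv
      ((Completable.congr hinv.agree).1 hc)
    · intro f hf ht
      rw [Finset.mem_singleton] at ht ⊢
      by_contra hne
      exact hno f ⟨hf, by rw [ht]; exact fun h => hne h.symm, by rw [ht]; exact hv⟩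
    · intro u hu
      rw [Finset.mem_singleton.1 hu]
      omega
  | @push f hf hmin =>
    obtain ⟨hfS, hloop, hdef⟩ := hf
    have hw := hS f hfS
    have hle : ∀ v, h v ≤ Function.update h (B.tail f) (h (B.head f) + 1) v := by
      intro v
      by_cases hv : v = B.tail f
      · subst hv
        simpa using hinv.valid.arc_le f hfS
      · simp [hv]
    -- The new labels are already valid before the reversal. For the other arcs leaving the
    -- relabelled vertex this needs the choice of a lowest head.
    have hval : ValidLabel w S B (Function.update h (B.tail f) (h (B.head f) + 1)) := by
      constructor
      · intro g hg
        by_cases hgl : B.tail g = B.head g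
        · rw [hgl]
          omega
        by_cases hgt : B.tail g = B.tail f
        · have h1 := hmin g ⟨hg, hgl, by rwa [hgt]⟩
          have h2 := hle (B.head g)
          rw [hgt, Function.update_self]
          omega
        · rw [Function.update_of_ne hgt]
          exact (hinv.valid.arc_le g hg).trans (Nat.add_le_add_right (hle _) 1)
      · intro v hv
        have hne : v ≠ B.tail f := by
          rintro rfl
          omega
        rw [Function.update_of_ne hne]
        exact hinv.valid.surplus v hv
    have hflow : ∀ v, inflow w (B.flip f) v + (if B.head f = v then 1 else 0) =
        inflow w B v + (if B.tail f = v then 1 else 0) := by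
      intro v
      have := inflow_flip w B f v
      rwa [hw] at this
    refine ⟨?_, ⟨?_, ?_⟩, ?_, ?_⟩
    · intro g hg
      have hgf : g ≠ f := fun h => hfS (h ▸ hg)
      rw [flip_arc_of_ne B hgf]
      exact hinv.agree g hg
    · intro g hg
      by_cases hgf : g = f
      · subst hgf
        have h1 : (B.flip g).tail g = B.head g := by simp [tail, head, flip_arc_self]
        have h2 : (B.flip g).head g = B.tail g := by simp [tail, head, flip_arc_self]
        rw [h1, h2, Function.update_self, Function.update_of_ne (Ne.symm hloop)]
        omega
      · have h1 : (B.flip f).tail g = B.tail g := by simp [tail, flip_arc_of_ne B hgf]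
        have h2 : (B.flip f).head g = B.head g := by simp [head, flip_arc_of_ne B hgf]
        rw [h1, h2]
        exact hval.arc_le g hg
    · intro v hv
      have := hflow v
      by_cases hvt : B.tail f = v
      · have h3 : B.head f ≠ v := by rw [← hvt]; exact Ne.symm hloop
        simp only [hvt, h3, if_true, if_false] at this
        rw [hvt] at hdef
        omega
      · simp only [hvt, if_false] at this
        refine hval.surplus v ?_
        omega
    · intro hc v
      by_cases hvt : v = B.tail f
      · subst hvt
        exact hval.lt_card ((Completable.congr hinv.agree).1 hc) hdef
      · rw [Function.update_of_ne hvt]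
        exact hinv.lt_card hc v
    · intro hc
      right
      have hprog : i ≤ ∑ v, inflow w B v * h v := by
        rcases hinv.progress hc with h1 | h1
        · have := h1 (B.tail f)
          omega
        · exact h1
      set h' := Function.update h (B.tail f) (h (B.head f) + 1) with hh'
      -- The balance of the reversal, weighted with the new labels; the head and tail terms differ
      -- by exactly one.
      have hsum : ∑ v, (inflow w (B.flip f) v + (if B.head f = v then 1 else 0)) * h' v =
          ∑ v, (inflow w B v + (if B.tail f = v then 1 else 0)) * h' v :=
        Finset.sum_congr rfl fun v _ => by rw [hflow v]
      simp only [add_mul, Finset.sum_add_distrib, ite_mul, one_mul, zero_mul,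
        Finset.sum_ite_eq, Finset.mem_univ, if_true] at hsum
      have h1 : h' (B.head f) = h (B.head f) := by
        rw [hh', Function.update_of_ne (Ne.symm hloop)]
      have h2 : h' (B.tail f) = h (B.head f) + 1 := by rw [hh', Function.update_self]
      have h3 : ∑ v, inflow w B v * h v ≤ ∑ v, inflow w B v * h' v :=
        Finset.sum_le_sum fun v _ => Nat.mul_le_mul_left _ (hle v)
      omega

/-- After `2 |V|²` steps the algorithm has decided completability. -/
theorem PushInv.decides [Nonempty V] {w : E → ℕ} {S : Set E} {B₀ B : EdgeOrientation ends}
    {h : V → ℕ} (hinv : PushInv w S B₀ (2 * (Fintype.card V * Fintype.card V)) B h) :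
    (∀ v, 2 ≤ inflow w B v) ↔ Completable w S B₀ := by
  refine ⟨fun hB => ⟨B, hinv.agree, hB⟩, fun hc => ?_⟩
  refine (hinv.progress hc).resolve_right fun hle => ?_
  -- Vertices with surplus have label zero; all others contribute at most `2 * h v`, with `h v`
  -- below `|V|`.
  have hlt : ∑ v, inflow w B v * h v < ∑ _v : V, 2 * Fintype.card V := by
    refine Finset.sum_lt_sum_of_nonempty Finset.univ_nonempty fun v _ => ?_
    have h1 := hinv.lt_card hc v
    by_cases h2 : 2 < inflow w B v
    · rw [hinv.valid.surplus v h2]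
      omega
    · calc inflow w B v * h v ≤ 2 * h v := Nat.mul_le_mul_right _ (by omega)
        _ < 2 * Fintype.card V := by omega
  rw [Finset.sum_const, Finset.card_univ, smul_eq_mul] at hlt
  have : Fintype.card V * (2 * Fintype.card V) = 2 * (Fintype.card V * Fintype.card V) := by ring
  omega

end Flow

end EdgeOrientation

/-! ### A language with variables, arrays and bounded loops, and its compilation

Programs work on variables and on eight unbounded arrays; the input word is read-only.  The only
loops are repetitions whose numbers of iterations are fixed in advance by limits. -/

namespace Loop

inductive Expr where
  | num (c : ℕ)
  | var (x : ℕ)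
  | add (e e' : Expr)
  | sub (e e' : Expr)
  /-- an entry of an array -/
  | get (a : Fin 8) (i : Expr)
  /-- an entry of the input word -/
  | inp (i : Expr)

inductive Cmd where
  | skip
  | set (x : ℕ) (e : Expr)
  | put (a : Fin 8) (i e : Expr)
  | seq (c c' : Cmd)
  | ite (e : Expr) (c c' : Cmd)
  /-- repeat `c`, as often as the limit `j` says -/
  | rep (j : ℕ) (c : Cmd)

structure St where
  var : ℕ → ℕ
  arr : Fin 8 → ℕ → ℕ

/-! #### Semantics and cost -/

def Expr.eval (l : List ℕ) (s : St) : Expr → ℕ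
  | .num c => c
  | .var x => s.var x
  | .add e e' => e.eval l s + e'.eval l s
  | .sub e e' => e.eval l s - e'.eval l s
  | .get a i => s.arr a (i.eval l s)
  | .inp i => l.getD (i.eval l s) 0

def St.set (s : St) (x v : ℕ) : St := { s with var := Function.update s.var x v }

def St.put (s : St) (a : Fin 8) (i v : ℕ) : St :=
  { s with arr := Function.update s.arr a (Function.update (s.arr a) i v) }

def Cmd.exec (l : List ℕ) (lim : ℕ → ℕ) : Cmd → St → St
  | .skip, s => s
  | .set x e, s => s.set x (e.eval l s)
  | .put a i e, s => s.put a (i.eval l s) (e.eval l s)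
  | .seq c c', s => c'.exec l lim (c.exec l lim s)
  | .ite e c c', s => if e.eval l s ≠ 0 then c.exec l lim s else c'.exec l lim s
  | .rep j c, s => (c.exec l lim)^[lim j] s

/-- Exact step counts of the compiled code. The 7 is six steps of address computation and one load;
the 3 is a bounds test (two steps) and a load or a zero. -/
def Expr.cost : Expr → ℕ
  | .num _ => 1
  | .var _ => 1
  | .add e e' => e.cost + (e'.cost + 1)
  | .sub e e' => e.cost + (e'.cost + 1)
  | .get _ i => i.cost + 7
  | .inp i => i.cost + 3

/-- Both branches of a conditional are charged, which makes the bound independent of the state. In a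
repetition, the 3 per round pays for the test and the decrement of the counter. -/
def Cmd.cost (lim : ℕ → ℕ) : Cmd → ℕ
  | .skip => 1
  | .set _ e => e.cost + 1
  | .put _ i e => i.cost + 6 + e.cost + 1
  | .seq c c' => c.cost lim + c'.cost lim
  | .ite e c c' => e.cost + (c.cost lim + c'.cost lim + 1)
  | .rep j c => 1 + (lim j * (c.cost lim + 3) + 1)

/-! #### The bound on the cost -/

/-- The 5 for a repetition is the overhead of 3 per round plus the two steps that load and finally
test the counter. -/
def Cmd.coef : Cmd → ℕ
  | .seq c c' => c.coef + c'.coef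
  | .ite e c c' => e.cost + (c.coef + c'.coef + 1)
  | .rep _ c => c.coef + 5
  | c => c.cost fun _ => 0

def Cmd.depth : Cmd → ℕ
  | .seq c c' => max c.depth c'.depth
  | .ite _ c c' => max c.depth c'.depth
  | .rep _ c => c.depth + 1
  | _ => 0

theorem Cmd.cost_le {lim : ℕ → ℕ} {y : ℕ} (hy : ∀ j, lim j ≤ y) (hy1 : 1 ≤ y) (c : Cmd) :
    c.cost lim ≤ c.coef * y ^ c.depth := by
  induction c with
  | skip => simp [cost, coef, depth]
  | set x e => simp [cost, coef, depth]
  | put a i e => simp [cost, coef, depth]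
  | seq c c' ih ih' =>
    have h1 : y ^ c.depth ≤ y ^ max c.depth c'.depth := Nat.pow_le_pow_right hy1 (le_max_left _ _)
    have h2 : y ^ c'.depth ≤ y ^ max c.depth c'.depth := Nat.pow_le_pow_right hy1 (le_max_right _ _)
    simp only [cost, coef, depth, add_mul]
    exact add_le_add (ih.trans (Nat.mul_le_mul_left _ h1)) (ih'.trans (Nat.mul_le_mul_left _ h2))
  | ite e c c' ih ih' =>
    have h1 : y ^ c.depth ≤ y ^ max c.depth c'.depth := Nat.pow_le_pow_right hy1 (le_max_left _ _)
    have h2 : y ^ c'.depth ≤ y ^ max c.depth c'.depth := Nat.pow_le_pow_right hy1 (le_max_right _ _)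
    have h3 : 1 ≤ y ^ max c.depth c'.depth := Nat.one_le_pow _ _ hy1
    simp only [cost, coef, depth, add_mul]
    exact add_le_add (Nat.le_mul_of_pos_right _ h3) (add_le_add
      (add_le_add (ih.trans (Nat.mul_le_mul_left _ h1)) (ih'.trans (Nat.mul_le_mul_left _ h2)))
      (by omega))
  | rep j c ih =>
    have h3 : 1 ≤ y ^ c.depth := Nat.one_le_pow _ _ hy1
    have h4 : y ^ c.depth ≤ y ^ c.depth * y := Nat.le_mul_of_pos_right _ hy1
    have h5 : lim j * (c.cost lim + 3) ≤ y * (c.coef * y ^ c.depth + 3 * y ^ c.depth) :=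
      Nat.mul_le_mul (hy j) (by omega)
    have h6 : (c.coef + 5) * (y ^ c.depth * y) =
      y * (c.coef * y ^ c.depth + 3 * y ^ c.depth) + 2 * (y ^ c.depth * y) := by ring
    simp only [cost, coef, depth, pow_succ]
    omega

/-! #### Commands that leave a variable or an array alone -/

def Cmd.keepsVar (x : ℕ) : Cmd → Bool
  | .set y _ => !(y == x)
  | .seq c c' => c.keepsVar x && c'.keepsVar x
  | .ite _ c c' => c.keepsVar x && c'.keepsVar x
  | .rep _ c => c.keepsVar x
  | _ => true

def Cmd.keepsArr (a : Fin 8) : Cmd → Bool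
  | .put b _ _ => !(b == a)
  | .seq c c' => c.keepsArr a && c'.keepsArr a
  | .ite _ c c' => c.keepsArr a && c'.keepsArr a
  | .rep _ c => c.keepsArr a
  | _ => true

theorem iterate_inv {α : Type*} {f : α → α} (I : ℕ → α → Prop) {N : ℕ}
    (hstep : ∀ i < N, ∀ s, I i s → I (i + 1) (f s)) {s : α} (h0 : I 0 s) : I N (f^[N] s) := by
  have : ∀ i, i ≤ N → I i (f^[i] s) := by
    intro i
    induction i with
    | zero => exact fun _ => h0
    | succ i ih =>
      intro hi
      rw [Function.iterate_succ_apply']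
      exact hstep i hi _ (ih (by omega))
  exact this N le_rfl

theorem Cmd.exec_var {l : List ℕ} {lim : ℕ → ℕ} {x : ℕ} (c : Cmd) (h : c.keepsVar x = true)
    (s : St) : (c.exec l lim s).var x = s.var x := by
  induction c generalizing s with
  | skip => rfl
  | set y e =>
    have : x ≠ y := by
      simp [keepsVar] at h
      exact Ne.symm h
    simp [exec, St.set, Function.update_of_ne this]
  | put a i e => rfl
  | seq c c' ih ih' =>
    simp [keepsVar] at h
    rw [exec, ih' h.2, ih h.1]
  | ite e c c' ih ih' =>
    simp [keepsVar] at h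
    rw [exec]
    split
    · exact ih h.1 s
    · exact ih' h.2 s
  | rep j c ih =>
    exact iterate_inv (fun _ s' => s'.var x = s.var x) (fun _ _ s' hs' => (ih h s').trans hs') rfl

theorem Cmd.exec_arr {l : List ℕ} {lim : ℕ → ℕ} {a : Fin 8} (c : Cmd) (h : c.keepsArr a = true)
    (s : St) : (c.exec l lim s).arr a = s.arr a := by
  induction c generalizing s with
  | skip => rfl
  | set y e => rfl
  | put b i e =>
    have : a ≠ b := by
      simp [keepsArr] at h
      exact Ne.symm h
    simp [exec, St.put, Function.update_of_ne this]
  | seq c c' ih ih' =>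
    simp [keepsArr] at h
    rw [exec, ih' h.2, ih h.1]
  | ite e c c' ih ih' =>
    simp [keepsArr] at h
    rw [exec]
    split
    · exact ih h.1 s
    · exact ih' h.2 s
  | rep j c ih =>
    exact iterate_inv (fun _ s' => s'.arr a = s.arr a) (fun _ _ s' hs' => (ih h s').trans hs') rfl

/-! #### Counting loops -/

/-- For `x` from zero to the limit `j` do `c`. -/
def Cmd.count (x j : ℕ) (c : Cmd) : Cmd :=
  .seq (.set x (.num 0)) (.rep j (.seq c (.set x (.add (.var x) (.num 1)))))

/-- The loop rule used for all counting loops. The invariant is asserted after the counter has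
advanced, and the body must not assign the counter. -/
theorem Cmd.exec_count {l : List ℕ} {lim : ℕ → ℕ} (I : ℕ → St → Prop) {x j : ℕ} {c : Cmd}
    (hx : c.keepsVar x = true) {s : St} (h0 : I 0 (s.set x 0))
    (hstep : ∀ i < lim j, ∀ s : St, s.var x = i → I i s → I (i + 1) ((c.exec l lim s).set x (i + 1))) :
    I (lim j) ((Cmd.count x j c).exec l lim s) := by
  have := iterate_inv (f := (Cmd.seq c (.set x (.add (.var x) (.num 1)))).exec l lim)
    (fun i s => s.var x = i ∧ I i s) (N := lim j) (s := s.set x 0) ?_ ?_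
  · exact this.2
  · rintro i hi s ⟨hsx, hI⟩
    have h1 : (c.exec l lim s).var x = i := (c.exec_var hx s).trans hsx
    have h2 : (Cmd.seq c (.set x (.add (.var x) (.num 1)))).exec l lim s =
        (c.exec l lim s).set x (i + 1) := by
      simp [exec, Expr.eval, h1]
    rw [h2]
    exact ⟨by simp [St.set], hstep i hi s hsx hI⟩
  · exact ⟨by simp [St.set], h0⟩

/-! #### Compilation

Variables, limits and temporary registers are interleaved.  The limit `0` is the length of the
input word; the arrays are interleaved in the memory behind it. -/

open RAM (Prog State Run)

/-- The registers of the variables. -/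
def vreg (x : ℕ) : ℕ := 3 * x

/-- The registers of the limits. -/
def lreg (j : ℕ) : ℕ := 3 * j + 1

/-- The temporary registers. -/
def treg (d : ℕ) : ℕ := 3 * d + 2

/-- Turn the index in the temporary register `d` into the address of an array entry. -/
def addrProg (a : Fin 8) (d : ℕ) : Prog :=
  .seq (.add (treg d) (treg d) (treg d)) <|
  .seq (.add (treg d) (treg d) (treg d)) <|
  .seq (.add (treg d) (treg d) (treg d)) <|
  .seq (.const (treg (d + 1)) a) <|
  .seq (.add (treg d) (treg d) (treg (d + 1))) <|
  .add (treg d) (treg d) (lreg 0)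

def Expr.compile : Expr → ℕ → Prog
  | .num c, d => .const (treg d) c
  | .var x, d => .copy (treg d) (vreg x)
  | .add e e', d => .seq (e.compile d) <| .seq (e'.compile (d + 1)) <|
      .add (treg d) (treg d) (treg (d + 1))
  | .sub e e', d => .seq (e.compile d) <| .seq (e'.compile (d + 1)) <|
      .sub (treg d) (treg d) (treg (d + 1))
  | .get a i, d => .seq (i.compile d) <| .seq (addrProg a d) <| .load (treg d) (treg d)
  | .inp i, d => .seq (i.compile d) <| .seq (.sub (treg (d + 1)) (lreg 0) (treg d)) <|
      .cond (treg (d + 1)) (.load (treg d) (treg d)) (.const (treg d) 0)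

def Cmd.compile : Cmd → ℕ → Prog
  | .skip, d => .const (treg d) 0
  | .set x e, d => .seq (e.compile d) (.copy (vreg x) (treg d))
  | .put a i e, d => .seq (i.compile d) <| .seq (addrProg a d) <| .seq (e.compile (d + 1)) <|
      .store (treg d) (treg (d + 1))
  | .seq c c', d => .seq (c.compile d) (c'.compile d)
  | .ite e c c', d => .seq (e.compile d) (.cond (treg d) (c.compile d) (c'.compile d))
  | .rep j c, d => .seq (.copy (treg d) (lreg j)) <| .loop (treg d) <|
      .seq (c.compile (d + 1)) <| .seq (.const (treg (d + 1)) 1) <|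
      .sub (treg d) (treg d) (treg (d + 1))

/-- The machine state `s` represents the program state `st`. -/
structure Rep (l : List ℕ) (lim : ℕ → ℕ) (st : St) (s : State) : Prop where
  var : ∀ x, s.reg (vreg x) = st.var x
  lim : ∀ j, s.reg (lreg j) = lim j
  inp : ∀ i < l.length, s.mem i = l.getD i 0
  arr : ∀ (a : Fin 8) i, s.mem (8 * i + a + l.length) = st.arr a i

theorem treg_ne_vreg (d x : ℕ) : vreg x ≠ treg d := by
  unfold treg vreg
  omega

theorem treg_ne_lreg (d x : ℕ) : lreg x ≠ treg d := by
  unfold treg lreg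
  omega

theorem vreg_ne_lreg (d x : ℕ) : lreg x ≠ vreg d := by
  unfold vreg lreg
  omega

theorem treg_inj {d d' : ℕ} : treg d = treg d' ↔ d = d' := by
  unfold treg
  omega

theorem vreg_inj {d d' : ℕ} : vreg d = vreg d' ↔ d = d' := by
  unfold vreg
  omega

/-- `s'` arises from `s` by changes in temporary registers, from number `d` on. -/
def SameUpTo (d : ℕ) (s s' : State) : Prop :=
  s'.mem = s.mem ∧ ∀ r, (∀ k, d ≤ k → r ≠ treg k) → s'.reg r = s.reg r

theorem SameUpTo.trans {d : ℕ} {s s' s'' : State} (h : SameUpTo d s s') (h' : SameUpTo d s' s'') :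
    SameUpTo d s s'' :=
  ⟨h'.1.trans h.1, fun r hr => (h'.2 r hr).trans (h.2 r hr)⟩

theorem SameUpTo.mono {d d' : ℕ} {s s' : State} (hd : d ≤ d') (h : SameUpTo d' s s') :
    SameUpTo d s s' :=
  ⟨h.1, fun r hr => h.2 r fun k hk => hr k (hd.trans hk)⟩

theorem SameUpTo.treg {d k : ℕ} {s s' : State} (h : SameUpTo d s s') (hk : k < d) :
    s'.reg (treg k) = s.reg (treg k) :=
  h.2 _ fun k' hk' => by rw [Ne, treg_inj]; omega

theorem sameUpTo_update {d k : ℕ} (s : State) (hk : d ≤ k) (v : ℕ) :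
    SameUpTo d s { s with reg := Function.update s.reg (Loop.treg k) v } :=
  ⟨rfl, fun _ hr => Function.update_of_ne (hr k hk) _ _⟩

theorem Rep.congr {l : List ℕ} {lim : ℕ → ℕ} {st : St} {s s' : State} {d : ℕ}
    (h : Rep l lim st s) (hs : SameUpTo d s s') : Rep l lim st s' where
  var x := (hs.2 _ fun _ _ => treg_ne_vreg _ _).trans (h.var x)
  lim x := (hs.2 _ fun _ _ => treg_ne_lreg _ _).trans (h.lim x)
  inp i hi := by rw [hs.1]; exact h.inp i hi
  arr a i := by rw [hs.1]; exact h.arr a i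

theorem run_addrProg (a : Fin 8) (d : ℕ) (s : State) :
    ∃ s', Run (addrProg a d) s 6 s' ∧ SameUpTo d s s' ∧
      s'.reg (treg d) = 8 * s.reg (treg d) + a + s.reg (lreg 0) := by
  refine ⟨_, .seq (.add _ _ _ _) (.seq (.add _ _ _ _) (.seq (.add _ _ _ _) (.seq (.const _ _ _)
    (.seq (.add _ _ _ _) (.add _ _ _ _))))), ?_, ?_⟩
  · have h1 := fun v s => sameUpTo_update (d := d) (k := d) s le_rfl v
    have h2 := fun v s => sameUpTo_update (d := d) (k := d + 1) s (Nat.le_succ d) v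
    exact (h1 _ _).trans <| (h1 _ _).trans <| (h1 _ _).trans <| (h2 _ _).trans <|
      (h1 _ _).trans (h1 _ _)
  · have h1 : treg (d + 1) ≠ treg d := by rw [Ne, treg_inj]; omega
    simp [h1.symm, treg_ne_lreg]
    ring

/-- The first operand waits in temporary `d` while the second is evaluated from `d + 1` on;
`SameUpTo` is what protects the waiting value. -/
theorem Expr.run_compile {l : List ℕ} {lim : ℕ → ℕ} (hlim : lim 0 = l.length) (e : Expr) :
    ∀ (d : ℕ) (st : St) (s : State), Rep l lim st s →
      ∃ s', Run (e.compile d) s e.cost s' ∧ SameUpTo d s s' ∧ s'.reg (treg d) = e.eval l st := by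
  induction e with
  | num c =>
    exact fun d st s _ => ⟨_, .const _ _ _, sameUpTo_update s le_rfl _, by simp [eval]⟩
  | var x =>
    exact fun d st s h => ⟨_, .copy _ _ _, sameUpTo_update s le_rfl _, by simp [eval, h.var]⟩
  | add e e' ih ih' =>
    intro d st s h
    obtain ⟨s1, hr1, hs1, hv1⟩ := ih d st s h
    obtain ⟨s2, hr2, hs2, hv2⟩ := ih' (d + 1) st s1 (h.congr hs1)
    refine ⟨_, .seq hr1 (.seq hr2 (.add _ _ _ _)), ?_, ?_⟩
    · exact (hs1.trans (hs2.mono (Nat.le_succ d))).trans (sameUpTo_update s2 le_rfl _)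
    · simp [eval, hv2, hs2.treg (Nat.lt_succ_self d), hv1]
  | sub e e' ih ih' =>
    intro d st s h
    obtain ⟨s1, hr1, hs1, hv1⟩ := ih d st s h
    obtain ⟨s2, hr2, hs2, hv2⟩ := ih' (d + 1) st s1 (h.congr hs1)
    refine ⟨_, .seq hr1 (.seq hr2 (.sub _ _ _ _)), ?_, ?_⟩
    · exact (hs1.trans (hs2.mono (Nat.le_succ d))).trans (sameUpTo_update s2 le_rfl _)
    · simp [eval, hv2, hs2.treg (Nat.lt_succ_self d), hv1]
  | get a i ih =>
    intro d st s h
    obtain ⟨s1, hr1, hs1, hv1⟩ := ih d st s h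
    obtain ⟨s2, hr2, hs2, hv2⟩ := run_addrProg a d s1
    refine ⟨_, .seq hr1 (.seq hr2 (.load _ _ _)), ?_, ?_⟩
    · exact (hs1.trans hs2).trans (sameUpTo_update s2 le_rfl _)
    · have h1 := h.congr hs1
      have h2 := h1.congr hs2
      rw [h1.lim, hlim, hv1] at hv2
      simp [eval, hv2, h2.arr]
  | inp i ih =>
    intro d st s h
    obtain ⟨s1, hr1, hs1, hv1⟩ := ih d st s h
    have h1 := h.congr hs1
    obtain ⟨s2, hs2⟩ : ∃ s2 : State, s2 =
      { s1 with reg := Function.update s1.reg (treg (d + 1)) (s1.reg (lreg 0) - s1.reg (treg d)) } := ⟨_, rfl⟩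
    have hr2 : Run (.sub (treg (d + 1)) (lreg 0) (treg d)) s1 1 s2 := hs2 ▸ .sub _ _ _ _
    have hs12 : SameUpTo d s1 s2 := hs2 ▸ sameUpTo_update s1 (Nat.le_succ d) _
    have h2 := h1.congr hs12
    have hv2 : s2.reg (treg (d + 1)) = l.length - i.eval l st := by
      simp [hs2, h1.lim, hlim, hv1]
    have hne : treg d ≠ treg (d + 1) := by rw [Ne, treg_inj]; omega
    have hd : s2.reg (treg d) = i.eval l st := by
      simp [hs2, hne, hv1]
    by_cases hi : i.eval l st < l.length
    · refine ⟨_, .seq hr1 (.seq hr2 (.cond_true (by rw [hv2]; omega) (.load _ _ _))), ?_, ?_⟩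
      · exact (hs1.trans hs12).trans (sameUpTo_update s2 le_rfl _)
      · simp [eval, hd, h2.inp _ hi]
    · refine ⟨_, .seq hr1 (.seq hr2 (.cond_false (by rw [hv2]; omega) (.const _ _ _))), ?_, ?_⟩
      · exact (hs1.trans hs12).trans (sameUpTo_update s2 le_rfl _)
      · simp only [not_lt] at hi
        simp [eval, hi]

/-- Temporaries below `d` must survive, since they hold the counters of enclosing repetitions and
the address of a pending store is kept in the same way. -/
theorem Cmd.run_compile {l : List ℕ} {lim : ℕ → ℕ} (hlim : lim 0 = l.length) (c : Cmd) :
    ∀ (d : ℕ) (st : St) (s : State), Rep l lim st s →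
      ∃ t s', Run (c.compile d) s t s' ∧ t ≤ c.cost lim ∧ Rep l lim (c.exec l lim st) s' ∧
        ∀ k < d, s'.reg (treg k) = s.reg (treg k) := by
  induction c with
  | skip =>
    intro d st s h
    have hs := sameUpTo_update (k := d) s le_rfl 0
    exact ⟨_, _, .const _ _ _, le_rfl, h.congr hs, fun k hk => hs.treg hk⟩
  | set x e =>
    intro d st s h
    obtain ⟨s1, hr1, hs1, hv1⟩ := e.run_compile hlim d st s h
    have h1 := h.congr hs1
    refine ⟨_, _, .seq hr1 (.copy _ _ _), le_rfl, ⟨?_, ?_, h1.inp, h1.arr⟩, ?_⟩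
    · intro y
      by_cases hy : y = x
      · subst hy
        simp [exec, St.set, hv1]
      · have : vreg y ≠ vreg x := fun h => hy (vreg_inj.1 h)
        simp [exec, St.set, this, hy, h1.var]
    · intro j
      simp [vreg_ne_lreg, h1.lim]
    · intro k hk
      simp [(treg_ne_vreg _ _).symm, hs1.treg hk]
  | put a i e =>
    intro d st s h
    obtain ⟨s1, hr1, hs1, hv1⟩ := i.run_compile hlim d st s h
    have h1 := h.congr hs1
    obtain ⟨s2, hr2, hs2, hv2⟩ := run_addrProg a d s1
    have h2 := h1.congr hs2
    obtain ⟨s3, hr3, hs3, hv3⟩ := e.run_compile hlim (d + 1) st s2 h2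
    have h3 := h2.congr hs3
    have hd : s3.reg (treg d) = 8 * i.eval l st + a + l.length := by
      rw [hs3.treg (Nat.lt_succ_self d), hv2, hv1, h1.lim, hlim]
    refine ⟨_, _, .seq hr1 (.seq hr2 (.seq hr3 (.store _ _ _))), ?_, ⟨h3.var, h3.lim, ?_, ?_⟩, ?_⟩
    · simp only [cost]
      omega
    · intro j hj
      have : j ≠ 8 * i.eval l st + a + l.length := by omega
      simp only [hd, hv3, Function.update_of_ne this]
      exact h3.inp j hj
    · intro b j
      simp only [hd, hv3]
      by_cases hb : b = a
      · subst hb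
        by_cases hj : j = i.eval l st
        · subst hj
          simp [exec, St.put]
        · have : 8 * j + (b : ℕ) + l.length ≠ 8 * i.eval l st + b + l.length := by omega
          rw [Function.update_of_ne this, h3.arr]
          simp [exec, St.put, hj]
      · have hb' : (b : ℕ) ≠ a := fun h => hb (Fin.ext h)
        have : 8 * j + (b : ℕ) + l.length ≠ 8 * i.eval l st + a + l.length := by omega
        rw [Function.update_of_ne this, h3.arr]
        simp [exec, St.put, hb]
    · intro k hk
      exact (hs3.treg (by omega)).trans ((hs2.treg hk).trans (hs1.treg hk))
  | seq c c' ih ih' =>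
    intro d st s h
    obtain ⟨t1, s1, hr1, ht1, h1, hk1⟩ := ih d st s h
    obtain ⟨t2, s2, hr2, ht2, h2, hk2⟩ := ih' d _ s1 h1
    exact ⟨_, _, .seq hr1 hr2, add_le_add ht1 ht2, h2, fun k hk => (hk2 k hk).trans (hk1 k hk)⟩
  | ite e c c' ih ih' =>
    intro d st s h
    obtain ⟨s1, hr1, hs1, hv1⟩ := e.run_compile hlim d st s h
    have h1 := h.congr hs1
    by_cases he : e.eval l st ≠ 0
    · obtain ⟨t2, s2, hr2, ht2, h2, hk2⟩ := ih d _ s1 h1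
      refine ⟨_, _, .seq hr1 (.cond_true (by rwa [hv1]) hr2), ?_, ?_,
        fun k hk => (hk2 k hk).trans (hs1.treg hk)⟩
      · simp only [cost]
        omega
      · rwa [exec, if_pos he]
    · obtain ⟨t2, s2, hr2, ht2, h2, hk2⟩ := ih' d _ s1 h1
      refine ⟨_, _, .seq hr1 (.cond_false (by rw [hv1]; exact not_not.1 he) hr2), ?_, ?_,
        fun k hk => (hk2 k hk).trans (hs1.treg hk)⟩
      · simp only [cost]
        omega
      · rwa [exec, if_neg he]
  | rep j c ih =>
    intro d st s h
    -- The machine counts down in temporary `d`, so the induction is on the number of rounds left,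
    -- for arbitrary states.
    have key : ∀ (N : ℕ) (st : St) (s : State), Rep l lim st s → s.reg (treg d) = N →
        ∃ t s', Run (.loop (treg d) <| .seq (c.compile (d + 1)) <|
          .seq (.const (treg (d + 1)) 1) <| .sub (treg d) (treg d) (treg (d + 1))) s t s' ∧
          t ≤ N * (c.cost lim + 3) + 1 ∧ Rep l lim ((c.exec l lim)^[N] st) s' ∧
          ∀ k < d, s'.reg (treg k) = s.reg (treg k) := by
      intro N
      induction N with
      | zero =>
        intro st s h h0
        exact ⟨_, _, .loop_exit h0, by omega, h, fun _ _ => rfl⟩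
      | succ N ihN =>
        intro st s h hN
        obtain ⟨t1, s1, hr1, ht1, h1, hk1⟩ := ih (d + 1) _ s h
        have hne : treg d ≠ treg (d + 1) := by rw [Ne, treg_inj]; omega
        have hs2 := sameUpTo_update (d := d) (k := d + 1) s1 (Nat.le_succ d) 1
        have hs3 := hs2.trans (sameUpTo_update (d := d) (k := d) _ le_rfl
          (s1.reg (treg d) - 1))
        have h3 := h1.congr hs3
        have hr3 : Run (.seq (.const (treg (d + 1)) 1) (.sub (treg d) (treg d) (treg (d + 1))))
            s1 2 ⟨Function.update (Function.update s1.reg (treg (d + 1)) 1) (treg d)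
              (s1.reg (treg d) - 1), s1.mem⟩ := by
          have := Run.seq (Run.const (treg (d + 1)) 1 s1) (Run.sub (treg d) (treg d) (treg (d + 1)) _)
          simpa [hne] using this
        obtain ⟨t4, s4, hr4, ht4, h4, hk4⟩ := ihN _ _ h3 (by
          simp [hk1 d (Nat.lt_succ_self d), hN])
        refine ⟨_, _, .loop_next (by omega) (.seq hr1 hr3) hr4, ?_, ?_, ?_⟩
        · rw [add_mul]
          omega
        · rwa [Function.iterate_succ_apply]
        · intro k hk
          exact (hk4 k hk).trans ((hs3.treg hk).trans (hk1 k (by omega)))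
    have hs1 := sameUpTo_update (d := d) (k := d) s le_rfl (lim j)
    obtain ⟨t2, s2, hr2, ht2, h2, hk2⟩ := key (lim j) st _ (h.congr hs1) (by simp)
    refine ⟨_, _, .seq (.copy _ _ _) (by rwa [h.lim]), ?_, h2,
      fun k hk => (hk2 k hk).trans (hs1.treg hk)⟩
    simp only [cost]
    omega

end Loop

/-! ### In-weights as inflows -/

namespace ConstraintGraph

open EdgeOrientation

variable {V E : Type*} [Fintype E] [DecidableEq V] {G : ConstraintGraph V E}

theorem Ori.inWeight_eq_inflow (A : G.Ori) (v : V) :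
    Ori.inWeight A v = inflow G.weight A v := by
  have h1 : (Ori.red A).indeg v =
      ∑ e ∈ Finset.univ.filter (fun e => G.weight e = 1), if A.head e = v then 1 else 0 := by
    rw [Finset.sum_subtype (p := fun e => G.weight e = 1) _ (by simp), indeg, Finset.card_filter]
    rfl
  have h2 : (Ori.blue A).indeg v =
      ∑ e ∈ Finset.univ.filter (fun e => G.weight e = 2), if A.head e = v then 1 else 0 := by
    rw [Finset.sum_subtype (p := fun e => G.weight e = 2) _ (by simp), indeg, Finset.card_filter]
    rfl
  rw [Ori.inWeight, h1, h2, Finset.sum_filter, Finset.sum_filter, Finset.mul_sum,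
    ← Finset.sum_add_distrib, inflow]
  refine Finset.sum_congr rfl fun e _ => ?_
  rcases G.weight_eq e with h | h <;> simp [h]

theorem Ori.feasible_iff {A : G.Ori} : Ori.Feasible A ↔ ∀ v, 2 ≤ inflow G.weight A v := by
  simp only [Ori.Feasible, Ori.inWeight_eq_inflow]

theorem Ori.Reaches.refl {A : G.Ori} (hA : Ori.Feasible A) : Ori.Reaches A A :=
  ⟨hA, Relation.ReflTransGen.refl⟩

theorem Ori.Reaches.tail {A B C : G.Ori} (h : Ori.Reaches A B) (hC : Ori.Feasible C)
    (hadj : B.Adj C) : Ori.Reaches A C :=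
  ⟨h.1, h.2.tail ⟨hC, hadj⟩⟩

theorem Ori.Reaches.feasible {A B : G.Ori} (h : Ori.Reaches A B) : Ori.Feasible B := by
  rcases Relation.ReflTransGen.cases_tail h.2 with h' | ⟨_, _, h'⟩
  · exact h' ▸ h.1
  · exact h'.1

/-- From a reachable configuration one can get to the inflows of any feasible orientation with the
same directions on a set that contains the blue edges. -/
theorem Ori.Reaches.exists_inflow_eq [Fintype V] [DecidableEq E] {A B C : G.Ori}
    (h : Ori.Reaches A B) (hC : Ori.Feasible C) (S : Set E) (hS : ∀ f, f ∉ S → G.weight f = 1)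
    (hBC : ∀ f ∈ S, C.arc f = B.arc f) :
    ∃ D : G.Ori, Ori.Reaches A D ∧ (∀ f ∈ S, D.arc f = B.arc f) ∧
      ∀ v, inflow G.weight D v = inflow G.weight C v := by
  obtain ⟨D, hD, hDS, hDC⟩ := exists_reaches_inflow_eq G.weight S hS (Ori.feasible_iff.1 hC) B
    (Ori.feasible_iff.1 h.feasible) hBC
  refine ⟨D, ⟨h.1, h.2.trans (hD.lift id
    fun _ _ h => ⟨Ori.feasible_iff.2 h.1, h.2⟩)⟩, hDS, hDC⟩

end ConstraintGraph

/-! ### Reversing one bit -/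

namespace Nat

/-- Adding `2 ^ r` where bit `r` is zero causes no carry. -/
theorem testBit_add_two_pow {c r : ℕ} (h : c.testBit r = false) (s : ℕ) :
    (c + 2 ^ r).testBit s = if s = r then true else c.testBit s := by
  induction r generalizing c s with
  | zero =>
    have h' : c % 2 = 0 := by
      simp at h
      omega
    cases s with
    | zero =>
      simp
      omega
    | succ s =>
      have : (c + 2 ^ 0) / 2 = c / 2 := by omega
      rw [testBit_succ, this, testBit_succ]
      simp
  | succ r ih =>
    cases s with
    | zero => simp [pow_succ, Nat.add_mul_mod_self_right]
    | succ s =>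
      have : (c + 2 ^ (r + 1)) / 2 = c / 2 + 2 ^ r := by omega
      rw [testBit_succ, this, ih (by rwa [testBit_succ] at h), testBit_succ]
      simp

/-- Reverse bit `r` of `c`. -/
def toggle (c r : ℕ) : ℕ := if c.testBit r then c - 2 ^ r else c + 2 ^ r

theorem testBit_toggle (c r s : ℕ) :
    (toggle c r).testBit s = if s = r then !c.testBit r else c.testBit s := by
  unfold toggle
  cases h : c.testBit r with
  | false => simpa using testBit_add_two_pow h s
  | true =>
    obtain ⟨d, rfl⟩ : ∃ d, c = 2 ^ r + d := Nat.exists_eq_add_of_le (Nat.ge_two_pow_of_testBit h)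
    rw [testBit_two_pow_add_eq] at h
    have hd : d.testBit r = false := by simpa using h
    have := testBit_add_two_pow hd s
    rw [add_comm] at this
    by_cases hs : s = r
    · simp [hs, hd]
    · simp [hs, this]

theorem toggle_lt {c r K : ℕ} (hc : c < 2 ^ K) (hr : r < K) : toggle c r < 2 ^ K := by
  refine Nat.lt_pow_two_of_testBit _ fun s hs => ?_
  rw [testBit_toggle, if_neg (by omega)]
  exact Nat.testBit_lt_two_pow (hc.trans_le (Nat.pow_le_pow_right (by omega) hs))

end Nat

/-! ### Codes for the directions of the selected edges -/

namespace C2EInstance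

open EdgeOrientation ConstraintGraph

variable (I : C2EInstance)

/-- The selected edges: the blue edges and the edge to reverse. -/
def sel : Set (Fin I.m) := {f | I.G.weight f = 2 ∨ f = I.e}

instance : DecidablePred (· ∈ I.sel) := fun f =>
  inferInstanceAs (Decidable (I.G.weight f = 2 ∨ f = I.e))

theorem weight_of_notMem_sel {f : Fin I.m} (h : f ∉ I.sel) : I.G.weight f = 1 :=
  (I.G.weight_eq f).resolve_right fun h' => h (Or.inl h')

/-- The number of selected edges before `i`. -/
def rank (i : ℕ) : ℕ := (Finset.univ.filter fun f : Fin I.m => f ∈ I.sel ∧ (f : ℕ) < i).card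

theorem rank_zero : I.rank 0 = 0 := by simp [rank]

theorem rank_succ (f : Fin I.m) : I.rank (f + 1) = I.rank f + if f ∈ I.sel then 1 else 0 := by
  unfold rank
  by_cases hf : f ∈ I.sel
  · rw [if_pos hf, ← Finset.card_insert_of_notMem (a := f) (by simp)]
    congr 1
    ext g
    simp only [Finset.mem_filter, Finset.mem_univ, true_and, Finset.mem_insert, Fin.ext_iff]
    constructor
    · rintro ⟨h1, h2⟩
      by_cases h : (g : ℕ) = f
      · exact Or.inl h
      · exact Or.inr ⟨h1, by omega⟩
    · rintro (h | h)
      · exact ⟨by rwa [Fin.ext h], by omega⟩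
      · exact ⟨h.1, by omega⟩
  · rw [if_neg hf, add_zero]
    congr 1
    ext g
    simp only [Finset.mem_filter, Finset.mem_univ, true_and]
    refine and_congr_right fun hg => ?_
    have : (g : ℕ) ≠ f := fun h => hf (Fin.ext h ▸ hg)
    omega

theorem rank_mono : Monotone I.rank := fun _ _ h =>
  Finset.card_le_card fun f hf => by
    simp only [Finset.mem_filter, Finset.mem_univ, true_and] at hf ⊢
    exact ⟨hf.1, by omega⟩

theorem rank_lt {f : Fin I.m} (hf : f ∈ I.sel) {i : ℕ} (hi : (f : ℕ) < i) : I.rank f < I.rank i := by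
  have := I.rank_mono (Nat.succ_le_of_lt hi)
  rw [Nat.succ_eq_add_one, rank_succ, if_pos hf] at this
  omega

theorem rank_ne {f g : Fin I.m} (hf : f ∈ I.sel) (hg : g ∈ I.sel) (h : f ≠ g) :
    I.rank f ≠ I.rank g := by
  rcases lt_or_gt_of_ne (fun h' => h (Fin.ext h') : (f : ℕ) ≠ g) with h' | h'
  · exact (I.rank_lt hf h').ne
  · exact (I.rank_lt hg h').ne'

theorem rank_m_le : I.rank I.m ≤ I.G.numBlue + 1 := by
  have h1 : I.G.numBlue = (Finset.univ.filter fun f => I.G.weight f = 2).card := by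
    rw [numBlue, Fintype.card_subtype]
  rw [h1, rank]
  refine le_trans (Finset.card_le_card ?_) (Finset.card_insert_le I.e _)
  intro f hf
  simp only [Finset.mem_filter, Finset.mem_univ, true_and, Finset.mem_insert] at hf ⊢
  exact hf.1.symm

/-- The orientation with code `c`: the arcs of the selected edges whose bits in `c` are one are
reversed. -/
def codeOri (c : ℕ) : I.G.Ori where
  arc f := if f ∈ I.sel ∧ c.testBit (I.rank f) then (I.A.arc f).swap else I.A.arc f
  ends_eq f := by
    have := I.A.ends_eq f
    split
    · simpa [Sym2.eq_swap] using this
    · exact this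

theorem codeOri_zero : I.codeOri 0 = I.A := by
  ext1
  funext f
  simp [codeOri]

theorem codeOri_toggle_of_ne {j f : Fin I.m} (hj : j ∈ I.sel) (hf : f ∈ I.sel) (h : f ≠ j) (c : ℕ) :
    (I.codeOri (c.toggle (I.rank j))).arc f = (I.codeOri c).arc f := by
  simp [codeOri, Nat.testBit_toggle, I.rank_ne hf hj h]

theorem codeOri_toggle_self {j : Fin I.m} (hj : j ∈ I.sel) (c : ℕ) :
    (I.codeOri (c.toggle (I.rank j))).arc j = ((I.codeOri c).arc j).swap := by
  simp only [codeOri, Nat.testBit_toggle, hj, true_and, if_true]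
  cases c.testBit (I.rank j) <;> simp

/-- The selected edges keep the directions of code `c`, and the vertices are supplied without the
edge `j`. -/
def Free (c : ℕ) (j : Fin I.m) : Prop :=
  Completable (Function.update I.G.weight j 0) I.sel (I.codeOri c)

/-- The code `c` stands for a reachable configuration. -/
def CodeReached (c : ℕ) : Prop :=
  ∃ B : I.G.Ori, Ori.Reaches I.A B ∧ ∀ f ∈ I.sel, B.arc f = (I.codeOri c).arc f

theorem codeReached_zero : I.CodeReached 0 :=
  ⟨I.A, .refl I.feasible, fun _ _ => by rw [codeOri_zero]⟩

variable {I}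

/-- Move the unselected edges to the inflows of a witness of `Free`. As `j` points the same way in
both orientations, the inflows without `j` agree as well, so `j` is not needed anywhere and can be
reversed. -/
theorem CodeReached.toggle {c : ℕ} (h : I.CodeReached c) {j : Fin I.m} (hj : j ∈ I.sel)
    (hfree : I.Free c j) : I.CodeReached (c.toggle (I.rank j)) := by
  obtain ⟨B, hB, hBc⟩ := h
  obtain ⟨C, hCc, hC⟩ := hfree
  have hCfeas : Ori.Feasible C := Ori.feasible_iff.2 fun v => by
    rw [inflow_eq_add I.G.weight j]
    exact (hC v).trans (Nat.le_add_right _ _)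
  obtain ⟨D, hD, hDB, hDC⟩ := hB.exists_inflow_eq hCfeas I.sel (fun f => I.weight_of_notMem_sel)
    (fun f hf => (hCc f hf).trans (hBc f hf).symm)
  have hDj : ∀ v, 2 ≤ inflow (Function.update I.G.weight j 0) D v := by
    intro v
    have h1 := hDC v
    have h2 : D.head j = C.head j := by
      rw [head, head, hDB j hj, hBc j hj, hCc j hj]
    rw [inflow_eq_add _ j, inflow_eq_add _ j C, h2] at h1
    have := hC v
    omega
  refine ⟨D.flip j, hD.tail (Ori.feasible_iff.2 fun v => ?_) (adj_flip D j), fun f hf => ?_⟩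
  · rw [inflow_eq_add I.G.weight j, inflow_update_flip]
    exact (hDj v).trans (Nat.le_add_right _ _)
  · by_cases hfj : f = j
    · subst hfj
      rw [flip_arc_self, codeOri_toggle_self I hf, hDB f hf, hBc f hf]
    · rw [flip_arc_of_ne D hfj, codeOri_toggle_of_ne I hj hf hfj, hDB f hf, hBc f hf]

/-- A set of codes that contains `0` and is closed under the possible reversals covers all
reachable configurations. -/
theorem exists_code_of_reaches {R : Set ℕ} (h0 : 0 ∈ R)
    (hR : ∀ c ∈ R, ∀ j ∈ I.sel, I.Free c j → c.toggle (I.rank j) ∈ R)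
    {B : I.G.Ori} (hB : Ori.Reaches I.A B) :
    ∃ c ∈ R, ∀ f ∈ I.sel, B.arc f = (I.codeOri c).arc f := by
  obtain ⟨_, hB⟩ := hB
  have hfeas : ∀ {C}, Relation.ReflTransGen
      (fun B B' : I.G.Ori => Ori.Feasible B' ∧ B.Adj B') I.A C → Ori.Feasible C :=
    fun h => Ori.Reaches.feasible ⟨I.feasible, h⟩
  induction hB with
  | refl => exact ⟨0, h0, fun _ _ => by rw [codeOri_zero]⟩
  | @tail C D hC hD ih =>
    obtain ⟨c, hc, hCc⟩ := ih
    obtain ⟨hDf, rfl | ⟨j, hj, hj'⟩⟩ := hD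
    · exact ⟨c, hc, hCc⟩
    obtain rfl := eq_flip hj hj'
    by_cases hjS : j ∈ I.sel
    -- Reversing a loop changes nothing. Otherwise each vertex is missed by `j` before or after the
    -- reversal, and feasibility of the corresponding orientation shows that the other edges suffice
    -- there.
    · by_cases hloop : C.tail j = C.head j
      · rw [flip_eq_self_of_loop hloop]
        exact ⟨c, hc, hCc⟩
      · refine ⟨_, hR c hc j hjS ⟨C, hCc, fun v => ?_⟩, fun f hf => ?_⟩
        · have h1 := Ori.feasible_iff.1 (hfeas hC) v
          have h2 := Ori.feasible_iff.1 hDf v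
          rw [inflow_eq_add _ j] at h1 h2
          rw [inflow_update_flip] at h2
          by_cases hv : C.head j = v
          · have : (C.flip j).head j ≠ v := by
              rw [← hv, head, flip_arc_self]
              exact hloop
            simpa [this] using h2
          · simpa [hv] using h1
        · by_cases hfj : f = j
          · subst hfj
            rw [flip_arc_self, codeOri_toggle_self I hf, hCc f hf]
          · rw [flip_arc_of_ne C hfj, codeOri_toggle_of_ne I hjS hf hfj, hCc f hf]
    · refine ⟨c, hc, fun f hf => ?_⟩
      have hfj : f ≠ j := fun h => hjS (h ▸ hf)
      rw [flip_arc_of_ne C hfj, hCc f hf]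

theorem mem_sel_e : I.e ∈ I.sel := Or.inr rfl

theorem CodeReached.yes {c : ℕ} (h : I.CodeReached c)
    (he : (I.codeOri c).arc I.e ≠ I.A.arc I.e) : I.Yes := by
  obtain ⟨B, hB, hBc⟩ := h
  exact ⟨B, hB, by rwa [hBc _ mem_sel_e]⟩

end C2EInstance

/-! ### The input word -/

namespace C2EInstance

open EdgeOrientation ConstraintGraph

variable (I : C2EInstance)

theorem length_encode : I.encode.length = 3 * I.m + 3 := by
  simp [encode, List.length_flatMap]
  ring

theorem getD_flatMap_triple {α : Type*} (a b c : α → ℕ) (L : List α) (i : ℕ) (hi : i < L.length) :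
    (L.flatMap fun x => [a x, b x, c x]).getD (i + i + i) 0 = a L[i] ∧
    (L.flatMap fun x => [a x, b x, c x]).getD (i + i + i + 1) 0 = b L[i] ∧
    (L.flatMap fun x => [a x, b x, c x]).getD (i + i + i + 2) 0 = c L[i] := by
  induction L generalizing i with
  | nil => simp at hi
  | cons x L ih =>
    cases i with
    | zero => simp
    | succ i =>
      have h := ih i (by simpa using hi)
      have e1 : i + 1 + (i + 1) + (i + 1) = i + i + i + 1 + 1 + 1 := by ring
      rw [e1]
      simpa [List.flatMap_cons] using h

theorem getD_encode_zero : I.encode.getD 0 0 = I.n := by simp [encode]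

theorem getD_encode_one : I.encode.getD 1 0 = I.m := by simp [encode]

theorem getD_encode_two : I.encode.getD 2 0 = I.e := by simp [encode]

theorem getD_encode_edge (f : Fin I.m) :
    I.encode.getD (3 + (f + f + f)) 0 = I.A.tail f ∧
    I.encode.getD (4 + (f + f + f)) 0 = I.A.head f ∧
    I.encode.getD (5 + (f + f + f)) 0 = I.G.weight f := by
  have h := getD_flatMap_triple (fun f => (I.A.tail f : ℕ)) (fun f => (I.A.head f : ℕ))
    I.G.weight (List.finRange I.m) f (by simp)
  simp only [List.getElem_finRange, Fin.cast_mk, Fin.eta] at h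
  have h3 : ∀ k, I.encode.getD (k + 3) 0 = ((List.finRange I.m).flatMap fun f =>
      [(I.A.tail f : ℕ), (I.A.head f : ℕ), I.G.weight f]).getD k 0 := by
    intro k
    simp [encode]
  refine ⟨?_, ?_, ?_⟩
  · rw [show 3 + ((f : ℕ) + f + f) = f + f + f + 3 by ring, h3, h.1]
  · rw [show 4 + ((f : ℕ) + f + f) = f + f + f + 1 + 3 by ring, h3, h.2.1]
  · rw [show 5 + ((f : ℕ) + f + f) = f + f + f + 2 + 3 by ring, h3, h.2.2]

instance : Nonempty (Fin I.n) := ⟨I.A.tail I.e⟩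

end C2EInstance

/-! ### The program -/

namespace Loop

-- variables
notation "vAns" => 0
notation "vV" => 1
notation "vF" => 2
notation "vC" => 3
notation "vJ" => 4
notation "vD" => 5
notation "vBF" => 6
notation "vBV" => 7
notation "vBX" => 8
notation "vBH" => 9
notation "vOk" => 10
notation "vP" => 11
notation "vQ" => 12
notation "vR" => 13
notation "vN" => 14
-- arrays
notation "aHalf" => 0
notation "aPar" => 1
notation "aReach" => 2
notation "aFlow" => 3
notation "aLab" => 4
notation "aTail" => 5
notation "aHead" => 6
notation "aFlip" => 7

namespace Expr

def tail₀ (f : Expr) : Expr := .inp (.add (.num 3) (.add (.add f f) f))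

def head₀ (f : Expr) : Expr := .inp (.add (.num 4) (.add (.add f f) f))

def weight (f : Expr) : Expr := .inp (.add (.num 5) (.add (.add f f) f))

/-- Nonzero if and only if the values differ. -/
def ne (e e' : Expr) : Expr := .add (.sub e e') (.sub e' e)

/-- Nonzero if and only if the edge `f` is selected. -/
def sel (f : Expr) : Expr :=
  .add (.sub (weight f) (.num 1)) (.sub (.num 1) (ne f (.inp (.num 2))))

theorem eval_ne (l : List ℕ) (s : St) (e e' : Expr) :
    (ne e e').eval l s ≠ 0 ↔ e.eval l s ≠ e'.eval l s := by
  simp only [ne, eval]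
  omega

variable {I : C2EInstance} {s : St} {e : Expr} {f : Fin I.m}

theorem eval_tail₀ (h : e.eval I.encode s = f) : (tail₀ e).eval I.encode s = I.A.tail f := by
  simp only [tail₀, eval, h, I.getD_encode_edge]

theorem eval_head₀ (h : e.eval I.encode s = f) : (head₀ e).eval I.encode s = I.A.head f := by
  simp only [head₀, eval, h, I.getD_encode_edge]

theorem eval_weight (h : e.eval I.encode s = f) : (weight e).eval I.encode s = I.G.weight f := by
  simp only [weight, eval, h, I.getD_encode_edge]

theorem eval_sel (h : e.eval I.encode s = f) : (sel e).eval I.encode s ≠ 0 ↔ f ∈ I.sel := by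
  have h1 := eval_weight h
  have h2 : f ∈ I.sel ↔ I.G.weight f = 2 ∨ (f : ℕ) = I.e := by
    simp [C2EInstance.sel, Fin.ext_iff]
  rw [h2]
  simp only [sel, ne, eval, h1, h, I.getD_encode_two]
  rcases I.G.weight_eq f with h | h <;> rw [h] <;> omega

end Expr

open Loop.Expr

/-- Compute two to the number of selected edges. -/
def sizeCmd : Cmd :=
  .seq (.set vN (.num 1)) <|
  .count vF 2 <| .ite (sel (.var vF)) (.set vN (.add (.var vN) (.var vN))) .skip

/-- Tabulate halves and parities. -/
def tableCmd : Cmd :=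
  .seq (.set vQ (.num 0)) <| .seq (.set vR (.num 0)) <|
  .count vC 3 <|
    .seq (.put aHalf (.var vC) (.var vQ)) <| .seq (.put aPar (.var vC) (.var vR)) <|
    .ite (.var vR) (.seq (.set vQ (.add (.var vQ) (.num 1))) (.set vR (.num 0)))
      (.set vR (.num 1))

/-- Write down the direction of the edge `vF`; its bit is the last one of `vD`. -/
def decodeStep : Cmd :=
  .seq
    (.ite (sel (.var vF))
      (.seq (.put aFlip (.var vF) (.get aPar (.var vD))) (.set vD (.get aHalf (.var vD))))
      (.put aFlip (.var vF) (.num 0)))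
    (.ite (.get aFlip (.var vF))
      (.seq (.put aTail (.var vF) (head₀ (.var vF))) (.put aHead (.var vF) (tail₀ (.var vF))))
      (.seq (.put aTail (.var vF) (tail₀ (.var vF))) (.put aHead (.var vF) (head₀ (.var vF)))))

/-- Write down the orientation with the code in `vC`. -/
def decodeCmd : Cmd := .seq (.set vD (.var vC)) (.count vF 2 decodeStep)

/-- Add the edge `vF` to the inflows, if it is not `vJ`. -/
def flowStep : Cmd :=
  .ite (ne (.var vF) (.var vJ))
    (.put aFlow (.get aHead (.var vF))
      (.add (.get aFlow (.get aHead (.var vF))) (weight (.var vF)))) .skip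

def clearStep : Cmd := .seq (.put aFlow (.var vV) (.num 0)) (.put aLab (.var vV) (.num 0))

/-- Compute the inflows without the edge `vJ`, and set all labels to zero. -/
def flowCmd : Cmd := .seq (.count vV 1 clearStep) (.count vF 2 flowStep)

/-- Compare the arc of `vF` with the best arc found so far. -/
def selectStep : Cmd :=
  .ite (sel (.var vF)) .skip <|
    .ite (ne (.get aTail (.var vF)) (.get aHead (.var vF)))
      (.ite (.sub (.num 2) (.get aFlow (.get aTail (.var vF))))
        (.ite (.add (.sub (.num 1) (.var vBH))
            (.sub (.var vBH) (.add (.get aLab (.get aHead (.var vF))) (.num 1))))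
          (.seq (.set vBF (.var vF)) (.set vBH (.add (.get aLab (.get aHead (.var vF))) (.num 1))))
          .skip)
        .skip)
      .skip

/-- Find an arc to push along; `vBH` is zero if there is none. -/
def selectCmd : Cmd := .seq (.set vBH (.num 0)) (.count vF 2 selectStep)

/-- Push along the arc that was found. -/
def applyCmd : Cmd :=
  .ite (.var vBH)
    (.seq (.set vBV (.get aTail (.var vBF))) <| .seq (.set vBX (.get aHead (.var vBF))) <|
     .seq (.put aLab (.var vBV) (.var vBH)) <|
     .seq (.put aTail (.var vBF) (.var vBX)) <| .seq (.put aHead (.var vBF) (.var vBV)) <|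
     .seq (.put aFlow (.var vBV) (.add (.get aFlow (.var vBV)) (.num 1)))
       (.put aFlow (.var vBX) (.sub (.get aFlow (.var vBX)) (.num 1))))
    .skip

def pushCmd : Cmd := .seq selectCmd applyCmd

def checkStep : Cmd :=
  .ite (.sub (.num 2) (.get aFlow (.var vV))) (.set vOk (.num 0)) .skip

/-- Check that all inflows are at least two. -/
def checkCmd : Cmd := .seq (.set vOk (.num 1)) (.count vV 1 checkStep)

/-- Decide whether the edge `vJ` can be reversed at code `vC`. -/
def freeCmd : Cmd :=
  .seq decodeCmd <| .seq flowCmd <| .seq (.rep 1 (.rep 1 (.seq pushCmd pushCmd))) checkCmd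

/-- Mark the code that arises from the code `vC` by the reversal of `vJ`, if this is possible. -/
def expandStep : Cmd :=
  .ite (sel (.var vJ))
    (.seq
      (.seq freeCmd <| .ite (.var vOk)
        (.ite (.get aFlip (.var vJ)) (.put aReach (.sub (.var vC) (.var vP)) (.num 1))
          (.put aReach (.add (.var vC) (.var vP)) (.num 1)))
        .skip)
      (.set vP (.add (.var vP) (.var vP))))
    .skip

/-- Mark the codes that arise from the code `vC` by the reversal of one edge. -/
def expandCmd : Cmd := .seq (.set vP (.num 1)) (.count vJ 2 expandStep)

def roundStep : Cmd := .ite (.get aReach (.var vC)) expandCmd .skip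

def roundCmd : Cmd := .count vC 3 roundStep

def answerStep : Cmd :=
  .ite (.get aReach (.var vC))
    (.seq decodeCmd <|
      .ite (ne (.get aTail (.inp (.num 2))) (tail₀ (.inp (.num 2)))) (.set vAns (.num 1)) .skip)
    .skip

/-- Look for a marked code that reverses the given edge. -/
def answerCmd : Cmd := .count vC 3 answerStep

def mainCmd : Cmd :=
  .seq tableCmd <| .seq (.put aReach (.num 0) (.num 1)) <| .seq (.rep 3 roundCmd) answerCmd

end Loop

/-! ### Correctness of the code count, the tables and the decoding -/

namespace Loop

open Loop.Expr EdgeOrientation ConstraintGraph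

theorem St.set_var (s : St) (x v y : ℕ) : (s.set x v).var y = if y = x then v else s.var y := by
  simp [St.set, Function.update_apply]

theorem St.set_arr (s : St) (x v : ℕ) : (s.set x v).arr = s.arr := rfl

theorem St.put_var (s : St) (a : Fin 8) (i v : ℕ) : (s.put a i v).var = s.var := rfl

theorem St.put_arr (s : St) (a : Fin 8) (i v : ℕ) (b : Fin 8) (j : ℕ) :
    (s.put a i v).arr b j = if b = a ∧ j = i then v else s.arr b j := by
  by_cases h : b = a
  · subst h
    simp [St.put, Function.update_apply]
  · simp [St.put, h]

variable {I : C2EInstance} {lim : ℕ → ℕ}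

theorem exec_ite_sel {s : St} {e : Expr} {f : Fin I.m} (h : e.eval I.encode s = f) (c c' : Cmd) :
    (Cmd.ite (sel e) c c').exec I.encode lim s =
      if f ∈ I.sel then c.exec I.encode lim s else c'.exec I.encode lim s := by
  rw [Cmd.exec]
  by_cases hf : f ∈ I.sel
  · rw [if_pos ((eval_sel h).2 hf), if_pos hf]
  · rw [if_neg (fun h' => hf ((eval_sel h).1 h')), if_neg hf]

theorem exec_ite_ne {l : List ℕ} {s : St} {e e' : Expr} (c c' : Cmd) :
    (Cmd.ite (ne e e') c c').exec l lim s =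
      if e.eval l s ≠ e'.eval l s then c.exec l lim s else c'.exec l lim s := by
  rw [Cmd.exec]
  simp only [eval_ne]

theorem exec_sizeCmd (h2 : lim 2 = I.m) (s : St) :
    (sizeCmd.exec I.encode lim s).var vN = 2 ^ I.rank I.m := by
  have := Cmd.exec_count (l := I.encode) (lim := lim) (x := vF) (j := 2)
    (c := .ite (sel (.var vF)) (.set vN (.add (.var vN) (.var vN))) .skip)
    (fun i s => s.var vN = 2 ^ I.rank i) rfl (s := s.set vN 1) ?_ ?_
  · rwa [h2] at this
  · simp [St.set_var, I.rank_zero]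
  · intro i hi s hF hs
    rw [h2] at hi
    rw [exec_ite_sel (f := ⟨i, hi⟩) (e := .var vF) hF, I.rank_succ ⟨i, hi⟩]
    split_ifs
    · simp [Cmd.exec, eval, St.set_var, hs, pow_succ]
      ring
    · simp [Cmd.exec, St.set_var, hs]

/-- The tables of halves and parities are correct up to `N`. -/
def Table (N : ℕ) (s : St) : Prop := ∀ c < N, s.arr aHalf c = c / 2 ∧ s.arr aPar c = c % 2

/-- The machine cannot divide, so quotient and remainder by two are carried along while counting. -/
theorem exec_tableCmd (s : St) (l : List ℕ) : Table (lim 3) (tableCmd.exec l lim s) := by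
  refine (Cmd.exec_count (l := l) (lim := lim) (x := vC) (j := 3)
    (fun i s => Table i s ∧ s.var vQ = i / 2 ∧ s.var vR = i % 2) rfl
      (s := (s.set vQ 0).set vR 0) ?_ ?_).1
  · simp [St.set_var, Table]
  · rintro i - s hC ⟨hT, hQ, hR⟩
    have hT' : ∀ s' : St, s'.arr = ((s.put aHalf i (i / 2)).put aPar i (i % 2)).arr →
        Table (i + 1) s' := by
      intro s' hs' c hc
      rw [hs']
      simp only [St.put_arr]
      by_cases hci : c = i
      · simp [hci]
      · simpa [hci] using hT c (by omega)
    have hi := Nat.mod_two_eq_zero_or_one i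
    simp only [Cmd.exec, eval, St.put_var, hC, hQ, hR]
    split_ifs with h
    · refine ⟨hT' _ rfl, ?_, ?_⟩ <;> simp [St.set_var] <;> omega
    · refine ⟨hT' _ rfl, ?_, ?_⟩ <;> simp [St.set_var, St.put_var, hQ] <;> omega

/-- The orientation `B` is written down. -/
def Stores (B : I.G.Ori) (s : St) : Prop :=
  ∀ f : Fin I.m, s.arr aTail f = B.tail f ∧ s.arr aHead f = B.head f

/-- Before edge `i` the variable `vD` holds `c / 2 ^ rank i`, so its parity is the bit of the next
selected edge. It never exceeds `c`, hence stays within the table. -/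
theorem exec_decodeCmd (h2 : lim 2 = I.m) {N c : ℕ} (hc : c < N) {s : St} (hT : Table N s)
    (hC : s.var vC = c) :
    Stores (I.codeOri c) (decodeCmd.exec I.encode lim s) ∧
      ∀ f ∈ I.sel, (decodeCmd.exec I.encode lim s).arr aFlip f =
        if c.testBit (I.rank f) then 1 else 0 := by
  have h := Cmd.exec_count (l := I.encode) (lim := lim) (x := vF) (j := 2) (c := decodeStep)
    (fun (i : ℕ) (s : St) => (∀ f : Fin I.m, (f : ℕ) < i →
      (s.arr aTail f = (I.codeOri c).tail f ∧ s.arr aHead f = (I.codeOri c).head f) ∧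
        (f ∈ I.sel → s.arr aFlip f = if c.testBit (I.rank f) then 1 else 0)) ∧
      Table N s ∧ s.var vD = c / 2 ^ I.rank i) rfl (s := s.set vD (s.var vC)) ?_ ?_
  · rw [h2] at h
    exact ⟨fun f => (h.1 f f.isLt).1, fun f => (h.1 f f.isLt).2⟩
  · refine ⟨fun f hf => absurd hf (Nat.not_lt_zero _), hT, ?_⟩
    simp [St.set_var, I.rank_zero, hC]
  · rintro i hi s hF ⟨hpre, hT, hD⟩
    rw [h2] at hi
    obtain ⟨f, rfl⟩ : ∃ f : Fin I.m, i = f := ⟨⟨i, hi⟩, rfl⟩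
    rw [I.rank_succ, decodeStep, Cmd.exec, exec_ite_sel (f := f) (e := .var vF) hF]
    have hDN : s.var vD < N := by
      rw [hD]
      exact (Nat.div_le_self _ _).trans_lt hc
    -- The second half of the step depends only on the flag just written, so selected and unselected
    -- edges share this argument.
    have key : ∀ (s' : St) (b q : ℕ), s'.arr = (s.put aFlip f b).arr → s'.var vF = f →
        b = (if f ∈ I.sel ∧ c.testBit (I.rank f) then 1 else 0) →
        s'.var vD = q →
        let s'' := (Cmd.ite (.get aFlip (.var vF))
          (.seq (.put aTail (.var vF) (head₀ (.var vF))) (.put aHead (.var vF) (tail₀ (.var vF))))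
          (.seq (.put aTail (.var vF) (tail₀ (.var vF)))
            (.put aHead (.var vF) (head₀ (.var vF))))).exec I.encode lim s'
        (∀ g : Fin I.m, (g : ℕ) < f + 1 →
          ((s''.set vF (f + 1)).arr aTail g = (I.codeOri c).tail g ∧
            (s''.set vF (f + 1)).arr aHead g = (I.codeOri c).head g) ∧
          (g ∈ I.sel → (s''.set vF (f + 1)).arr aFlip g =
            if c.testBit (I.rank g) then 1 else 0)) ∧
        Table N (s''.set vF (f + 1)) ∧
        (s''.set vF (f + 1)).var vD = q := by
      intro s' b q harr hF' hb hD'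
      have ht : ∀ s₁ : St, s₁.var vF = f → (tail₀ (.var vF)).eval I.encode s₁ = I.A.tail f :=
        fun s₁ h => eval_tail₀ (e := .var vF) h
      have hh : ∀ s₁ : St, s₁.var vF = f → (head₀ (.var vF)).eval I.encode s₁ = I.A.head f :=
        fun s₁ h => eval_head₀ (e := .var vF) h
      have hbf : s'.arr aFlip f = b := by rw [harr, St.put_arr]; simp
      have hne : ∀ g : Fin I.m, g ≠ f → (g : ℕ) ≠ f := fun g h h' => h (Fin.ext h')
      simp only [Cmd.exec, eval, hF', hbf, ht, hh, St.put_var]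
      split_ifs with h0
      · have hrev : f ∈ I.sel ∧ c.testBit (I.rank f) = true := by
          by_contra h
          rw [if_neg h] at hb
          exact h0 hb
        refine ⟨fun g hg => ?_, ?_, ?_⟩
        · by_cases hgf : g = f
          · subst hgf
            simp [St.set_arr, St.put_arr, harr, hb, hrev, tail, head, C2EInstance.codeOri]
          · have := hpre g (by have := hne g hgf; omega)
            simpa [St.set_arr, St.put_arr, harr, hne g hgf] using this
        · intro d hd
          simpa [St.set_arr, St.put_arr, harr] using hT d hd
        · simpa [St.set_var, St.put_var] using hD'
      · have hrev : ¬ (f ∈ I.sel ∧ c.testBit (I.rank f) = true) := by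
          intro h
          rw [if_pos h] at hb
          omega
        refine ⟨fun g hg => ?_, ?_, ?_⟩
        · by_cases hgf : g = f
          · subst hgf
            refine ⟨?_, fun hgs => ?_⟩
            · simp [St.set_arr, St.put_arr, tail, head, C2EInstance.codeOri, hrev]
            · have : c.testBit (I.rank g) = false := by simpa [hgs] using hrev
              simp [St.set_arr, St.put_arr, harr, hb, this]
          · have := hpre g (by have := hne g hgf; omega)
            simpa [St.set_arr, St.put_arr, harr, hne g hgf] using this
        · intro d hd
          simpa [St.set_arr, St.put_arr, harr] using hT d hd
        · simpa [St.set_var, St.put_var] using hD'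
    by_cases hf : f ∈ I.sel
    · rw [if_pos hf]
      refine key _ (s.arr aPar (s.var vD)) _ ?_ ?_ ?_ ?_
      · simp [Cmd.exec, eval, St.set_arr, hF]
      · simp [Cmd.exec, eval, St.set_var, St.put_var, hF]
      · rw [(hT _ hDN).2, hD]
        simp only [hf, true_and, Nat.testBit_eq_decide_div_mod_eq, decide_eq_true_eq]
        split_ifs <;> omega
      · simp only [Cmd.exec, eval, St.set_var, if_true, St.put_var, hF, hf]
        rw [St.put_arr, if_neg (fun h => absurd h.1 (by decide)), (hT _ hDN).1, hD, Nat.div_div_eq_div_mul,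
          pow_succ]
    · rw [if_neg hf]
      refine key _ 0 _ ?_ ?_ ?_ ?_
      · simp [Cmd.exec, eval, hF]
      · simp [Cmd.exec, St.put_var, hF]
      · simp [hf]
      · simp [Cmd.exec, St.put_var, hD, hf]

end Loop

/-! ### Correctness of the push procedure -/

namespace Loop

open Loop.Expr EdgeOrientation ConstraintGraph

variable {I : C2EInstance} {lim : ℕ → ℕ}

/-- The orientation `B`, its inflows and the labels `h` are written down. -/
structure Holds (w : Fin I.m → ℕ) (B : I.G.Ori) (h : Fin I.n → ℕ) (s : St) : Prop where
  stores : Stores B s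
  flow : ∀ v : Fin I.n, s.arr aFlow v = inflow w B v
  lab : ∀ v : Fin I.n, s.arr aLab v = h v

theorem Holds.congr {w : Fin I.m → ℕ} {B : I.G.Ori} {h : Fin I.n → ℕ} {s s' : St}
    (hs : Holds w B h s) (h' : s'.arr = s.arr) : Holds w B h s' :=
  ⟨by rw [Stores, h']; exact hs.stores, by rw [h']; exact hs.flow, by rw [h']; exact hs.lab⟩

theorem sum_lt_succ {m : ℕ} (P : Fin m → Prop) [DecidablePred P] (w : Fin m → ℕ) (f : Fin m) :
    (∑ g : Fin m, if (g : ℕ) < f + 1 ∧ P g then w g else 0) =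
      (∑ g : Fin m, if (g : ℕ) < f ∧ P g then w g else 0) + if P f then w f else 0 := by
  have h1 : (if P f then w f else 0) = ∑ g : Fin m, if g = f then (if P g then w g else 0) else 0 := by
    simp
  rw [h1, ← Finset.sum_add_distrib]
  refine Finset.sum_congr rfl fun g _ => ?_
  by_cases hg : g = f
  · subst hg
    simp
  · have h2 : (g : ℕ) ≠ f := fun h => hg (Fin.ext h)
    have h3 : (g : ℕ) < f + 1 ↔ (g : ℕ) < f := by omega
    simp [hg, h3]

/-- Skipping the edge in `vJ` amounts to giving it weight zero. -/
theorem exec_flowCmd (h1 : lim 1 = I.n) (h2 : lim 2 = I.m) {j : Fin I.m} {B : I.G.Ori} {s : St}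
    (hB : Stores B s) (hJ : s.var vJ = j) :
    Holds (Function.update I.G.weight j 0) B (fun _ => 0) (flowCmd.exec I.encode lim s) := by
  set w := Function.update I.G.weight j 0 with hw
  have hclear := Cmd.exec_count (l := I.encode) (lim := lim) (x := vV) (j := 1) (c := clearStep)
    (fun (i : ℕ) (s : St) => Stores B s ∧ s.var vJ = j ∧
      ∀ v < i, s.arr aFlow v = 0 ∧ s.arr aLab v = 0) rfl (s := s)
    ⟨hB, hJ, fun v hv => absurd hv (Nat.not_lt_zero _)⟩ ?_
  · rw [h1] at hclear
    have hflow := Cmd.exec_count (l := I.encode) (lim := lim) (x := vF) (j := 2) (c := flowStep)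
      (fun (i : ℕ) (s : St) => Stores B s ∧ s.var vJ = j ∧ (∀ v < I.n, s.arr aLab v = 0) ∧
        ∀ v : Fin I.n, s.arr aFlow v =
          ∑ f : Fin I.m, if (f : ℕ) < i ∧ B.head f = v then w f else 0) rfl
      (s := (Cmd.count vV 1 clearStep).exec I.encode lim s) ?_ ?_
    · rw [h2] at hflow
      obtain ⟨hB', -, hlab, hfl⟩ := hflow
      refine ⟨hB', fun v => (hfl v).trans ?_, fun v => hlab v v.isLt⟩
      simp [inflow]
    · refine ⟨hclear.1, hclear.2.1, fun v hv => (hclear.2.2 v hv).2, fun v => ?_⟩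
      simpa [St.set_arr] using (hclear.2.2 v v.isLt).1
    · rintro i hi s hF ⟨hB, hJ, hlab, hfl⟩
      rw [h2] at hi
      obtain ⟨f, rfl⟩ : ∃ f : Fin I.m, i = f := ⟨⟨i, hi⟩, rfl⟩
      rw [flowStep, exec_ite_ne]
      simp only [eval, hF, hJ]
      have hwf := eval_weight (I := I) (e := .var vF) hF
      split_ifs with hne
      · have hjf : f ≠ j := fun h => hne (congrArg _ h)
        refine ⟨fun g => ?_, ?_, ?_, ?_⟩
        · simpa [Cmd.exec, eval, St.set_arr, St.put_arr] using hB g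
        · simpa [Cmd.exec, St.set_var, St.put_var] using hJ
        · simpa [Cmd.exec, St.set_arr, St.put_arr] using hlab
        · intro v
          rw [sum_lt_succ, ← hfl]
          simp only [Cmd.exec, eval, St.set_arr, St.put_arr, hF, (hB f).2, hwf, hw,
            Function.update_of_ne hjf, true_and]
          by_cases hv : B.head f = v
          · simp [hv]
          · have : (v : ℕ) ≠ B.head f := fun h => hv (Fin.ext h.symm)
            simp [hv, this]
      · have hjf : f = j := Fin.ext (not_not.1 hne)
        refine ⟨hB, ?_, hlab, ?_⟩
        · simpa [Cmd.exec, St.set_var] using hJ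
        · intro v
          rw [sum_lt_succ, ← hfl]
          simp [Cmd.exec, St.set_arr, hw, hjf]
  · rintro i - s hV ⟨hB, hJ, h0⟩
    refine ⟨fun g => ?_, ?_, fun v hv => ?_⟩
    · simpa [clearStep, Cmd.exec, eval, St.set_arr, St.put_arr] using hB g
    · simpa [clearStep, Cmd.exec, St.set_var, St.put_var] using hJ
    · simp only [clearStep, Cmd.exec, eval, St.set_arr, St.put_arr, St.put_var, hV]
      by_cases hvi : v = i
      · simp [hvi]
      · simpa [hvi] using h0 v (by omega)

/-- The candidate that was found among the edges before `i`. -/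
def Selected (w : Fin I.m → ℕ) (B : I.G.Ori) (h : Fin I.n → ℕ) (i : ℕ) (s : St) : Prop :=
  (s.var vBH = 0 ∧ ∀ f : Fin I.m, (f : ℕ) < i → ¬ CanPush w I.sel B f) ∨
  ∃ f : Fin I.m, s.var vBF = f ∧ s.var vBH = h (B.head f) + 1 ∧ CanPush w I.sel B f ∧
    ∀ g : Fin I.m, (g : ℕ) < i → CanPush w I.sel B g → h (B.head f) ≤ h (B.head g)

/-- A minimum search over the labels of heads. The stored value is the label plus one, which leaves
zero to mean that nothing was found. -/
theorem exec_selectCmd (h2 : lim 2 = I.m) {w : Fin I.m → ℕ} {B : I.G.Ori} {h : Fin I.n → ℕ} {s : St}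
    (hs : Holds w B h s) : Holds w B h (selectCmd.exec I.encode lim s) ∧
      Selected w B h I.m (selectCmd.exec I.encode lim s) := by
  have hcount := Cmd.exec_count (l := I.encode) (lim := lim) (x := vF) (j := 2) (c := selectStep)
    (fun (i : ℕ) (s : St) => Holds w B h s ∧ Selected w B h i s) rfl (s := s.set vBH 0) ?_ ?_
  · rwa [h2] at hcount
  · exact ⟨hs.congr rfl, Or.inl ⟨by simp [St.set_var], fun f hf => absurd hf (Nat.not_lt_zero _)⟩⟩
  · rintro i hi s hF ⟨hs, hsel⟩
    rw [h2] at hi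
    obtain ⟨f, rfl⟩ : ∃ f : Fin I.m, i = f := ⟨⟨i, hi⟩, rfl⟩
    have hlt : ∀ g : Fin I.m, (g : ℕ) < f + 1 → (g : ℕ) < f ∨ g = f := by
      intro g hg
      by_cases hgf : (g : ℕ) = f
      · exact Or.inr (Fin.ext hgf)
      · exact Or.inl (by omega)
    have hskip : (CanPush w I.sel B f → s.var vBH ≠ 0 ∧ s.var vBH ≤ h (B.head f) + 1) →
        Holds w B h (s.set vF (f + 1)) ∧ Selected w B h (f + 1) (s.set vF (f + 1)) := by
      intro hcan
      refine ⟨hs.congr rfl, ?_⟩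
      rcases hsel with ⟨h0, hno⟩ | ⟨g, hg, hh, hg', hmin⟩
      · refine Or.inl ⟨by simpa [St.set_var] using h0, fun g hg => ?_⟩
        rcases hlt g hg with hg | rfl
        · exact hno g hg
        · exact fun hg' => (hcan hg').1 h0
      · refine Or.inr ⟨g, by simpa [St.set_var] using hg, by simpa [St.set_var] using hh, hg', ?_⟩
        intro k hk hk'
        rcases hlt k hk with hk | rfl
        · exact hmin k hk hk'
        · have := (hcan hk').2
          omega
    rw [selectStep, exec_ite_sel (f := f) (e := .var vF) hF]
    split_ifs with hfs
    · exact hskip fun hcan => absurd hfs hcan.1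
    rw [exec_ite_ne]
    simp only [eval, hF, (hs.stores f).1, (hs.stores f).2]
    split_ifs with hne
    swap
    · exact hskip fun hcan => absurd (Fin.ext (not_not.1 hne)) hcan.2.1
    rw [Cmd.exec]
    simp only [eval, hF, (hs.stores f).1, hs.flow]
    split_ifs with hdef
    swap
    · exact hskip fun hcan => absurd hcan.2.2 (by omega)
    rw [Cmd.exec]
    simp only [eval, hF, (hs.stores f).2, hs.lab]
    split_ifs with hbest
    swap
    · exact hskip fun _ => by omega
    have hcan : CanPush w I.sel B f := ⟨hfs, fun h => hne (congrArg _ h), by omega⟩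
    refine ⟨hs.congr rfl, Or.inr ⟨f, ?_, ?_, hcan, fun g hg hg' => ?_⟩⟩
    · simp [Cmd.exec, eval, St.set_var, hF]
    · simp [Cmd.exec, eval, St.set_var, St.set_arr, hF, (hs.stores f).2, hs.lab]
    · rcases hlt g hg with hg | rfl
      · rcases hsel with ⟨h0, hno⟩ | ⟨k, hk, hh, hk', hmin⟩
        · exact absurd hg' (hno g hg)
        · have := hmin g hg hg'
          omega
      · exact le_rfl

theorem exec_pushCmd (h2 : lim 2 = I.m) {w : Fin I.m → ℕ} (hw : ∀ f, f ∉ I.sel → w f = 1)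
    {B : I.G.Ori} {h : Fin I.n → ℕ} {s : St} (hs : Holds w B h s) :
    ∃ (B' : I.G.Ori) (h' : Fin I.n → ℕ), PushStep w I.sel B h B' h' ∧
      Holds w B' h' (pushCmd.exec I.encode lim s) := by
  obtain ⟨hs', hsel⟩ := exec_selectCmd h2 hs
  rw [pushCmd, Cmd.exec]
  set s' := selectCmd.exec I.encode lim s
  rcases hsel with ⟨h0, hno⟩ | ⟨f, hf, hh, hcan, hmin⟩
  · refine ⟨B, h, .idle fun f => hno f f.isLt, ?_⟩
    rw [applyCmd, Cmd.exec, if_neg (by simp [eval, h0])]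
    exact hs'
  · refine ⟨_, _, .push hcan fun g => hmin g g.isLt, ?_⟩
    rw [applyCmd, Cmd.exec, if_pos (by simp [eval, hh])]
    -- The pushed arc is no loop, so the writes at its two ends do not interfere.
    have hne : ((B.tail f : Fin I.n) : ℕ) ≠ B.head f := fun h => hcan.2.1 (Fin.ext h)
    refine ⟨fun g => ?_, fun v => ?_, fun v => ?_⟩
    · by_cases hg : g = f
      · subst hg
        simp [Cmd.exec, eval, St.set_arr, St.put_arr, St.set_var, St.put_var, hf,
          (hs'.stores g).1, (hs'.stores g).2, tail, head, flip_arc_self]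
      · have hg' : (g : ℕ) ≠ f := fun h => hg (Fin.ext h)
        have h1 : (B.flip f).tail g = B.tail g := by simp [tail, flip_arc_of_ne B hg]
        have h3 : (B.flip f).head g = B.head g := by simp [head, flip_arc_of_ne B hg]
        simp [Cmd.exec, eval, St.set_arr, St.put_arr, St.set_var, St.put_var, hf,
          hs'.stores g, hg', h1, h3]
    · have hfl := inflow_flip w B f v
      -- The arc itself supplies its head, so the truncated subtraction of one is exact.
      have hx : 1 ≤ inflow w B (B.head f) := by
        have := inflow_eq_add w f B (B.head f)
        rw [if_pos rfl, hw f hcan.1] at this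
        omega
      rw [hw f hcan.1] at hfl
      simp only [Cmd.exec, eval, St.set_arr, St.put_arr, St.set_var, St.put_var, hf,
        (hs'.stores f).1]
      by_cases hvt : v = B.tail f
      · subst hvt
        have : B.head f ≠ B.tail f := fun h => hcan.2.1 h.symm
        simp only [this, if_true, if_false] at hfl
        simp [hne, (hs'.stores f).2, hs'.flow]
        omega
      · have hvt' : (v : ℕ) ≠ B.tail f := fun h => hvt (Fin.ext h)
        by_cases hvh : v = B.head f
        · subst hvh
          simp only [if_true, Ne.symm hvt, if_false] at hfl
          simp [hne.symm, (hs'.stores f).2, hs'.flow]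
          omega
        · have hvh' : (v : ℕ) ≠ B.head f := fun h => hvh (Fin.ext h)
          simp only [Ne.symm hvt, Ne.symm hvh, if_false] at hfl
          simp [hvt', hvh', (hs'.stores f).2, hs'.flow]
          omega
    · simp only [Cmd.exec, eval, St.set_arr, St.put_arr, St.set_var, St.put_var, hf,
        (hs'.stores f).1]
      by_cases hvt : v = B.tail f
      · subst hvt
        simp [hh]
      · have hvt' : (v : ℕ) ≠ B.tail f := fun h => hvt (Fin.ext h)
        simp [hvt, hvt', hs'.lab]

theorem exec_checkCmd (h1 : lim 1 = I.n) {w : Fin I.m → ℕ} {B : I.G.Ori} {h : Fin I.n → ℕ} {s : St}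
    (hs : Holds w B h s) :
    (checkCmd.exec I.encode lim s).var vOk ≠ 0 ↔ ∀ v, 2 ≤ inflow w B v := by
  have hcount := Cmd.exec_count (l := I.encode) (lim := lim) (x := vV) (j := 1) (c := checkStep)
    (fun (i : ℕ) (s : St) => Holds w B h s ∧
      (s.var vOk ≠ 0 ↔ ∀ v : Fin I.n, (v : ℕ) < i → 2 ≤ inflow w B v)) rfl (s := s.set vOk 1) ?_ ?_
  · rw [h1] at hcount
    exact hcount.2.trans ⟨fun h v => h v v.isLt, fun h v _ => h v⟩
  · exact ⟨hs.congr rfl, by simp [St.set_var]⟩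
  · rintro i hi s hV ⟨hs, hok⟩
    rw [h1] at hi
    obtain ⟨v, rfl⟩ : ∃ v : Fin I.n, i = v := ⟨⟨i, hi⟩, rfl⟩
    have hlt : (∀ u : Fin I.n, (u : ℕ) < v + 1 → 2 ≤ inflow w B u) ↔
        (∀ u : Fin I.n, (u : ℕ) < v → 2 ≤ inflow w B u) ∧ 2 ≤ inflow w B v := by
      refine ⟨fun h => ⟨fun u hu => h u (by omega), h v (by omega)⟩, fun h u hu => ?_⟩
      by_cases huv : (u : ℕ) = v
      · rw [Fin.ext huv]
        exact h.2
      · exact h.1 u (by omega)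
    rw [checkStep, Cmd.exec, hlt]
    simp only [eval, hV, hs.flow]
    split_ifs with hdef
    · refine ⟨hs.congr rfl, ?_⟩
      simp only [Cmd.exec, eval, St.set_var]
      simp
      omega
    · refine ⟨hs.congr rfl, ?_⟩
      simp only [Cmd.exec, St.set_var]
      simp only [show ¬ (vOk = vV) by decide, if_false, hok]
      have : 2 ≤ inflow w B v := by omega
      simp [this]

theorem exec_freeCmd (h1 : lim 1 = I.n) (h2 : lim 2 = I.m) {N c : ℕ} (hc : c < N) {s : St}
    (hT : Table N s) (hC : s.var vC = c) {j : Fin I.m} (hj : j ∈ I.sel) (hJ : s.var vJ = j) :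
    ((freeCmd.exec I.encode lim s).var vOk ≠ 0 ↔ I.Free c j) ∧
      (freeCmd.exec I.encode lim s).arr aFlip j = if c.testBit (I.rank j) then 1 else 0 := by
  obtain ⟨hB, hflip⟩ := exec_decodeCmd h2 hc hT hC
  have hflow := exec_flowCmd h1 h2 (j := j) hB (by rw [Cmd.exec_var _ rfl, hJ])
  set w := Function.update I.G.weight j 0 with hw
  have hw1 : ∀ f, f ∉ I.sel → w f = 1 := by
    intro f hf
    have hfj : f ≠ j := fun h => hf (h ▸ hj)
    rw [hw, Function.update_of_ne hfj, I.weight_of_notMem_sel hf]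
  constructor
  · have hpush : ∀ i s, (∃ B h, Holds w B h s ∧ PushInv w I.sel (I.codeOri c) i B h) →
        ∃ B h, Holds w B h (pushCmd.exec I.encode lim s) ∧
          PushInv w I.sel (I.codeOri c) (i + 1) B h := by
      rintro i s ⟨B, h, hs, hinv⟩
      obtain ⟨B', h', hstep, hs'⟩ := exec_pushCmd h2 hw1 hs
      exact ⟨B', h', hs', hinv.step hw1 hstep⟩
    have hall : ∀ s, (∃ B h, Holds w B h s ∧ PushInv w I.sel (I.codeOri c) 0 B h) →
        ∃ B h, Holds w B h
          ((Cmd.rep 1 (.rep 1 (.seq pushCmd pushCmd))).exec I.encode lim s) ∧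
          PushInv w I.sel (I.codeOri c) (2 * (Fintype.card (Fin I.n) * Fintype.card (Fin I.n)))
            B h := by
      intro s hs
      -- Two nested repetitions of a double push give `2 * n * n` pushes, the number required by
      -- `PushInv.decides`.
      have h3 : (Cmd.rep 1 (.rep 1 (.seq pushCmd pushCmd))).exec I.encode lim s =
          (pushCmd.exec I.encode lim)^[2 * (I.n * I.n)] s := by
        rw [Function.iterate_mul, Function.iterate_mul]
        simp only [Cmd.exec, h1]
        rfl
      rw [h3, Fintype.card_fin]
      exact iterate_inv (fun i s => ∃ B h, Holds w B h s ∧ PushInv w I.sel (I.codeOri c) i B h)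
        (fun i _ => hpush i) hs
    obtain ⟨B, h, hs, hinv⟩ := hall _ ⟨_, _, hflow, .init⟩
    exact (exec_checkCmd h1 hs).trans hinv.decides
  · rw [freeCmd, Cmd.exec, Cmd.exec_arr _ rfl]
    exact hflip j hj

end Loop

/-! ### Correctness of the search among the codes -/

namespace Loop

open Loop.Expr EdgeOrientation ConstraintGraph

variable {I : C2EInstance} {lim : ℕ → ℕ}

/-- The tables are correct, the codes in `M` are marked, and only codes of reachable
configurations are marked. -/
structure Marks (I : C2EInstance) (N : ℕ) (M : Set ℕ) (s : St) : Prop where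
  table : Table N s
  sound : ∀ c < N, s.arr aReach c ≠ 0 → I.CodeReached c
  marked : ∀ c ∈ M, s.arr aReach c ≠ 0

theorem Marks.congr {N : ℕ} {M : Set ℕ} {s s' : St} (h : Marks I N M s)
    (h0 : s'.arr aHalf = s.arr aHalf) (h1 : s'.arr aPar = s.arr aPar)
    (h2 : s'.arr aReach = s.arr aReach) : Marks I N M s' :=
  ⟨by rw [Table, h0, h1]; exact h.table, by rw [h2]; exact h.sound, by rw [h2]; exact h.marked⟩

theorem Marks.mono {N : ℕ} {M M' : Set ℕ} {s : St} (h : Marks I N M s) (hM : M' ⊆ M) :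
    Marks I N M' s :=
  ⟨h.table, h.sound, fun c hc => h.marked c (hM hc)⟩

theorem Marks.put {N : ℕ} {M : Set ℕ} {s : St} (h : Marks I N M s) {c : ℕ}
    (hc : I.CodeReached c) : Marks I N (insert c M) (s.put aReach c 1) := by
  refine ⟨fun d hd => ?_, fun d hd => ?_, fun d hd => ?_⟩
  · simpa [St.put_arr] using h.table d hd
  · simp only [St.put_arr, true_and]
    by_cases hdc : d = c
    · exact fun _ => hdc ▸ hc
    · simpa [hdc] using h.sound d hd
  · simp only [St.put_arr, true_and]
    by_cases hdc : d = c
    · simp [hdc]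
    · simpa [hdc] using h.marked d (hd.resolve_left hdc)

/-- The variable `vP` doubles after each selected edge, so it equals `2 ^ rank j` when `j` is
treated; the flag from decoding tells whether to add or subtract it. -/
theorem exec_expandCmd (h1 : lim 1 = I.n) (h2 : lim 2 = I.m) {N c : ℕ}
    (hc : c < N) {M : Set ℕ} {s : St} (hs : Marks I N M s) (hC : s.var vC = c)
    (hreach : I.CodeReached c) :
    Marks I N (M ∪ {d | ∃ j ∈ I.sel, I.Free c j ∧ d = c.toggle (I.rank j)})
      (expandCmd.exec I.encode lim s) := by
  have hcount := Cmd.exec_count (l := I.encode) (lim := lim) (x := vJ) (j := 2) (c := expandStep)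
    (fun (i : ℕ) (s : St) => Marks I N
        (M ∪ {d | ∃ j ∈ I.sel, (j : ℕ) < i ∧ I.Free c j ∧ d = c.toggle (I.rank j)}) s ∧
      s.var vC = c ∧ s.var vP = 2 ^ I.rank i) rfl (s := s.set vP 1) ?_ ?_
  · rw [h2] at hcount
    refine hcount.1.mono (Set.union_subset_union_right _ ?_)
    rintro d ⟨j, hj, hd⟩
    exact ⟨j, hj, j.isLt, hd⟩
  · refine ⟨(hs.mono ?_).congr rfl rfl rfl, by simpa [St.set_var] using hC,
      by simp [St.set_var, I.rank_zero]⟩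
    refine Set.union_subset subset_rfl ?_
    rintro d ⟨j, -, hj, -⟩
    exact absurd hj (Nat.not_lt_zero _)
  · rintro i hi s hJ ⟨hs, hC, hP⟩
    rw [h2] at hi
    obtain ⟨j, rfl⟩ : ∃ j : Fin I.m, i = j := ⟨⟨i, hi⟩, rfl⟩
    rw [expandStep, exec_ite_sel (f := j) (e := .var vJ) hJ, I.rank_succ]
    have hsub : ∀ K : Set ℕ,
        M ∪ {d | ∃ k ∈ I.sel, (k : ℕ) < j ∧ I.Free c k ∧ d = c.toggle (I.rank k)} ⊆ K →
        (j ∈ I.sel → I.Free c j → c.toggle (I.rank j) ∈ K) →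
        M ∪ {d | ∃ k ∈ I.sel, (k : ℕ) < j + 1 ∧ I.Free c k ∧ d = c.toggle (I.rank k)} ⊆ K := by
      intro K hK hj
      refine Set.union_subset (Set.subset_union_left.trans hK) ?_
      rintro d ⟨k, hk, hkj, hfree, rfl⟩
      by_cases hkj' : (k : ℕ) = j
      · obtain rfl := Fin.ext hkj'
        exact hj hk hfree
      · exact hK (Or.inr ⟨k, hk, by omega, hfree, rfl⟩)
    by_cases hj : j ∈ I.sel
    · rw [if_pos hj, if_pos hj]
      obtain ⟨hok, hflip⟩ := exec_freeCmd h1 h2 hc hs.table hC hj hJ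
      have hs1 : Marks I N _ (freeCmd.exec I.encode lim s) :=
        hs.congr (Cmd.exec_arr _ rfl _) (Cmd.exec_arr _ rfl _) (Cmd.exec_arr _ rfl _)
      have hC1 : (freeCmd.exec I.encode lim s).var vC = c := (Cmd.exec_var _ rfl _).trans hC
      have hP1 : (freeCmd.exec I.encode lim s).var vP = 2 ^ I.rank j :=
        (Cmd.exec_var _ rfl _).trans hP
      rw [Cmd.exec, Cmd.exec, Cmd.exec]
      set s1 := freeCmd.exec I.encode lim s
      rw [Cmd.exec]
      have hok' : (Expr.var vOk).eval I.encode s1 ≠ 0 ↔ I.Free c j := hok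
      by_cases hfree : I.Free c j
      · rw [if_pos (hok'.2 hfree)]
        have hput : (Cmd.ite (.get aFlip (.var vJ)) (.put aReach (.sub (.var vC) (.var vP)) (.num 1))
            (.put aReach (.add (.var vC) (.var vP)) (.num 1))).exec I.encode lim s1 =
            s1.put aReach (c.toggle (I.rank j)) 1 := by
          have hJ1 : s1.var vJ = j := (Cmd.exec_var _ rfl _).trans hJ
          simp only [Cmd.exec, eval, hJ1, hflip, hC1, hP1, Nat.toggle]
          cases c.testBit (I.rank j) <;> simp
        rw [hput]
        have hs2 := hs1.put (hreach.toggle hj hfree)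
        refine ⟨(hs2.mono (hsub _ (Set.subset_insert _ _) fun _ _ => Set.mem_insert _ _)).congr
          rfl rfl rfl, ?_, ?_⟩
        · simpa [Cmd.exec, St.set_var, St.put_var] using hC1
        · simp [eval, St.set_var, St.put_var, hP1, pow_succ]
          ring
      · rw [if_neg (fun h => hfree (hok'.1 h)), Cmd.exec]
        refine ⟨(hs1.mono (hsub _ subset_rfl fun _ h => absurd h hfree)).congr rfl rfl rfl, ?_, ?_⟩
        · simpa [Cmd.exec, St.set_var] using hC1
        · simp [eval, St.set_var, hP1, pow_succ]
          ring
    · rw [if_neg hj, if_neg hj, Cmd.exec]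
      refine ⟨(hs.mono (hsub _ subset_rfl fun h => absurd h hj)).congr rfl rfl rfl, ?_, ?_⟩
      · simpa [St.set_var] using hC
      · simpa [St.set_var] using hP

/-- Codes marked during a round may be expanded in the same round. Therefore `M` is only a lower
bound for the marks, while soundness covers all of them. -/
theorem exec_roundCmd (h1 : lim 1 = I.n) (h2 : lim 2 = I.m) {M : Set ℕ} {s : St}
    (hs : Marks I (lim 3) M s) :
    Marks I (lim 3) (M ∪ {d | ∃ c ∈ M, c < lim 3 ∧ ∃ j ∈ I.sel, I.Free c j ∧
      d = c.toggle (I.rank j)}) (roundCmd.exec I.encode lim s) := by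
  have hcount := Cmd.exec_count (l := I.encode) (lim := lim) (x := vC) (j := 3) (c := roundStep)
    (fun (i : ℕ) (s : St) => Marks I (lim 3) (M ∪ {d | ∃ c ∈ M, c < i ∧ ∃ j ∈ I.sel, I.Free c j ∧
      d = c.toggle (I.rank j)}) s) rfl (s := s) ?_ ?_
  · exact hcount
  · refine (hs.mono (Set.union_subset subset_rfl ?_)).congr rfl rfl rfl
    rintro d ⟨c, -, hc, -⟩
    exact absurd hc (Nat.not_lt_zero _)
  · rintro c hc s hC hs
    have hsub : ∀ K : Set ℕ,
        M ∪ {d | ∃ b ∈ M, b < c ∧ ∃ j ∈ I.sel, I.Free b j ∧ d = b.toggle (I.rank j)} ⊆ K →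
        (c ∈ M → ∀ j ∈ I.sel, I.Free c j → c.toggle (I.rank j) ∈ K) →
        M ∪ {d | ∃ b ∈ M, b < c + 1 ∧ ∃ j ∈ I.sel, I.Free b j ∧ d = b.toggle (I.rank j)} ⊆ K := by
      intro K hK hcK
      refine Set.union_subset (Set.subset_union_left.trans hK) ?_
      rintro d ⟨b, hb, hbc, j, hj, hfree, rfl⟩
      by_cases h : b = c
      · subst h
        exact hcK hb j hj hfree
      · exact hK (Or.inr ⟨b, hb, by omega, j, hj, hfree, rfl⟩)
    rw [roundStep, Cmd.exec]
    simp only [eval, hC]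
    split_ifs with hr
    · refine ((exec_expandCmd h1 h2 hc hs hC (hs.sound c hc hr)).mono
        (hsub _ Set.subset_union_left fun _ j hj hfree => Or.inr ⟨j, hj, hfree, rfl⟩)).congr
          rfl rfl rfl
    · refine (hs.mono (hsub _ subset_rfl fun hcM => ?_)).congr rfl rfl rfl
      exact absurd (hs.marked c (Or.inl hcM)) hr

/-- After all rounds the marked codes contain a closed set. -/
theorem exec_rounds (h1 : lim 1 = I.n) (h2 : lim 2 = I.m) (h3 : lim 3 = 2 ^ I.rank I.m) {s : St}
    (hs : Marks I (lim 3) {0} s) :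
    ∃ M : Set ℕ, Marks I (lim 3) M ((Cmd.rep 3 roundCmd).exec I.encode lim s) ∧ 0 ∈ M ∧
      (∀ c ∈ M, c < lim 3) ∧
      ∀ c ∈ M, ∀ j ∈ I.sel, I.Free c j → c.toggle (I.rank j) ∈ M := by
  have hrounds := iterate_inv (f := roundCmd.exec I.encode lim) (N := lim 3) (s := s)
    (fun i s => ∃ M : Finset ℕ, Marks I (lim 3) M s ∧ 0 ∈ M ∧ M ⊆ Finset.range (lim 3) ∧
      -- Until the set is closed, each round adds a code, starting from one code; `lim 3` rounds
      -- would give more codes than exist.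
      ((∀ c ∈ M, ∀ j ∈ I.sel, I.Free c j → c.toggle (I.rank j) ∈ M) ∨ i + 1 ≤ M.card)) ?_ ?_
  · obtain ⟨M, hM, h0, hN, hclosed⟩ := hrounds
    refine ⟨M, hM, h0, fun c hc => Finset.mem_range.1 (hN hc), hclosed.resolve_right fun h => ?_⟩
    have := Finset.card_le_card hN
    rw [Finset.card_range] at this
    omega
  · rintro i - s ⟨M, hM, h0, hN, hcase⟩
    have hround := exec_roundCmd h1 h2 hM
    by_cases hclosed : ∀ c ∈ M, ∀ j ∈ I.sel, I.Free c j → c.toggle (I.rank j) ∈ M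
    · exact ⟨M, hround.mono Set.subset_union_left, h0, hN, Or.inl hclosed⟩
    · have hcard := hcase.resolve_left hclosed
      push Not at hclosed
      obtain ⟨c, hc, j, hj, hfree, hnot⟩ := hclosed
      have hcN : c < lim 3 := Finset.mem_range.1 (hN hc)
      refine ⟨insert (c.toggle (I.rank j)) M, hround.mono ?_, Finset.mem_insert_of_mem h0, ?_,
        Or.inr ?_⟩
      · rw [Finset.coe_insert]
        exact Set.insert_subset (Or.inr ⟨c, hc, hcN, j, hj, hfree, rfl⟩) Set.subset_union_left
      · refine Finset.insert_subset (Finset.mem_range.2 ?_) hN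
        rw [h3] at hcN ⊢
        exact Nat.toggle_lt hcN (I.rank_lt hj j.isLt)
      · rw [Finset.card_insert_of_notMem hnot]
        omega
  · refine ⟨{0}, by simpa using hs, by simp, ?_, Or.inr (by simp)⟩
    simp [h3]

/-- Comparing tails suffices: if an arc and its reversal have the same tail, the edge is a loop. -/
theorem tail_ne_iff {V E : Type*} {ends : E → Sym2 V} (A B : EdgeOrientation ends) (e : E) :
    B.tail e ≠ A.tail e ↔ B.arc e ≠ A.arc e := by
  refine not_congr ⟨fun h => ?_, fun h => by rw [tail, tail, h]⟩
  rcases arc_eq_or_swap A B e with h' | h'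
  · exact h'
  · rw [tail, tail, h'] at h
    rw [h']
    exact Prod.ext h h.symm

/-- A yes-instance is detected because the closed set `M` covers all reachable configurations. A
no-instance is safe because every mark, in `M` or not, stands for a reachable configuration. -/
theorem exec_answerCmd (h2 : lim 2 = I.m) {M : Set ℕ} {s : St}
    (hs : Marks I (lim 3) M s) (h0 : 0 ∈ M) (hN : ∀ c ∈ M, c < lim 3)
    (hclosed : ∀ c ∈ M, ∀ j ∈ I.sel, I.Free c j → c.toggle (I.rank j) ∈ M)
    (hans : s.var vAns = 0) :
    (I.Yes → (answerCmd.exec I.encode lim s).var vAns = 1) ∧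
      (¬ I.Yes → (answerCmd.exec I.encode lim s).var vAns = 0) := by
  have hcount := Cmd.exec_count (l := I.encode) (lim := lim) (x := vC) (j := 3) (c := answerStep)
    (fun (i : ℕ) (s : St) => Marks I (lim 3) M s ∧ (¬ I.Yes → s.var vAns = 0) ∧
      ∀ c ∈ M, c < i → (I.codeOri c).arc I.e ≠ I.A.arc I.e → s.var vAns = 1) rfl
    (s := s) ?_ ?_
  · refine ⟨?_, hcount.2.1⟩
    rintro ⟨B, hB, hBe⟩
    obtain ⟨c, hc, hcB⟩ := C2EInstance.exists_code_of_reaches h0 hclosed hB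
    refine hcount.2.2 c hc (hN c hc) ?_
    rwa [← hcB _ C2EInstance.mem_sel_e]
  · refine ⟨hs.congr rfl rfl rfl, fun _ => by simpa [St.set_var] using hans, fun c _ hc => ?_⟩
    exact absurd hc (Nat.not_lt_zero _)
  · rintro c hc s hC ⟨hs, hno, hyes⟩
    have hlt : ∀ d, d < c + 1 → d < c ∨ d = c := fun d hd => by omega
    rw [answerStep, Cmd.exec]
    simp only [eval, hC]
    split_ifs with hr
    · obtain ⟨hB, -⟩ := exec_decodeCmd h2 hc hs.table hC
      have hs1 : Marks I (lim 3) M (decodeCmd.exec I.encode lim s) :=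
        hs.congr (Cmd.exec_arr _ rfl _) (Cmd.exec_arr _ rfl _) (Cmd.exec_arr _ rfl _)
      have hA1 : (decodeCmd.exec I.encode lim s).var vAns = s.var vAns := Cmd.exec_var _ rfl _
      rw [Cmd.exec]
      set s1 := decodeCmd.exec I.encode lim s
      have he : (Expr.inp (.num 2)).eval I.encode s1 = I.e := I.getD_encode_two
      rw [exec_ite_ne, eval_tail₀ he]
      simp only [Expr.eval, I.getD_encode_two, (hB _).1]
      split_ifs with hne
      · have hne' : (I.codeOri c).arc I.e ≠ I.A.arc I.e :=
          (tail_ne_iff _ _ _).1 fun h => hne (congrArg _ h)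
        refine ⟨hs1.congr rfl rfl rfl, fun h => absurd ((hs.sound c hc hr).yes hne') h, ?_⟩
        intro d _ _ _
        simp [Cmd.exec, eval, St.set_var]
      · refine ⟨hs1.congr rfl rfl rfl, ?_, fun d hd hdc hde => ?_⟩
        · simpa [Cmd.exec, St.set_var, hA1] using hno
        · rcases hlt d hdc with hdc | rfl
          · simpa [Cmd.exec, St.set_var, hA1] using hyes d hd hdc hde
          · exact absurd (fun h => hne (fun h' => h (Fin.ext h'))) (not_not.2 ((tail_ne_iff _ _ _).2 hde))
    · refine ⟨hs.congr rfl rfl rfl, ?_, fun d hd hdc hde => ?_⟩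
      · simpa [Cmd.exec, St.set_var] using hno
      · rcases hlt d hdc with hdc | rfl
        · simpa [Cmd.exec, St.set_var] using hyes d hd hdc hde
        · exact absurd (hs.marked d hd) hr

theorem exec_mainCmd (h1 : lim 1 = I.n) (h2 : lim 2 = I.m) (h3 : lim 3 = 2 ^ I.rank I.m) {s : St}
    (harr : ∀ i, s.arr aReach i = 0) (hans : s.var vAns = 0) :
    (I.Yes → (mainCmd.exec I.encode lim s).var vAns = 1) ∧
      (¬ I.Yes → (mainCmd.exec I.encode lim s).var vAns = 0) := by
  have hT := exec_tableCmd (lim := lim) s I.encode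
  have hinit : Marks I (lim 3) {0} ((tableCmd.exec I.encode lim s).put aReach 0 1) := by
    have : Marks I (lim 3) ∅ (tableCmd.exec I.encode lim s) := by
      refine ⟨hT, fun c _ hc => ?_, fun c hc => absurd hc (Set.notMem_empty c)⟩
      rw [Cmd.exec_arr _ rfl, harr] at hc
      exact absurd rfl hc
    simpa using this.put I.codeReached_zero
  obtain ⟨M, hM, h0, hN, hclosed⟩ := exec_rounds h1 h2 h3 hinit
  refine exec_answerCmd h2 hM h0 hN hclosed ?_
  rw [Cmd.exec_var _ rfl, Cmd.exec_var _ rfl, Cmd.exec_var _ rfl, hans]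

end Loop

/-! ### The complete program and its running time -/

namespace Loop

open ConstraintGraph
open RAM (Prog State Run)

/-- Set the limits to the length of the input word and the numbers of vertices and edges. -/
def setupProg : Prog :=
  .seq (.const (treg 0) 1) <| .seq (.load (lreg 2) (treg 0)) <|
  .seq (.const (treg 0) 0) <| .seq (.load (lreg 1) (treg 0)) <|
  .seq (.const (treg 0) 3) <| .seq (.add (lreg 0) (treg 0) (lreg 2)) <|
  .seq (.add (lreg 0) (lreg 0) (lreg 2)) (.add (lreg 0) (lreg 0) (lreg 2))

def c2eProg : Prog :=
  .seq setupProg <| .seq (sizeCmd.compile 0) <| .seq (.copy (lreg 3) (vreg vN)) (mainCmd.compile 0)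

variable (I : C2EInstance)

/-- The limits that the set-up provides. -/
def baseLim : ℕ → ℕ
  | 0 => I.encode.length
  | 1 => I.n
  | 2 => I.m
  | _ => 0

theorem run_setupProg : ∃ s, Run setupProg (RAM.init I.encode) 8 s ∧
    Rep I.encode (baseLim I) ⟨fun _ => 0, fun _ _ => 0⟩ s := by
  refine ⟨_, .seq (.const _ _ _) (.seq (.load _ _ _) (.seq (.const _ _ _) (.seq (.load _ _ _)
    (.seq (.const _ _ _) (.seq (.add _ _ _ _) (.seq (.add _ _ _ _) (.add _ _ _ _))))))),
    fun x => ?_, fun j => ?_, fun i _ => rfl, fun a i => ?_⟩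
  · simp [RAM.init, treg_ne_vreg, (vreg_ne_lreg _ _).symm]
  · have hlen := I.length_encode
    have h0 : ∀ j, (RAM.init I.encode).reg j = 0 := fun _ => rfl
    have h1 : (RAM.init I.encode).mem 0 = I.n := I.getD_encode_zero
    have h2 : (RAM.init I.encode).mem 1 = I.m := I.getD_encode_one
    have h3 : ∀ j j', lreg j = lreg j' ↔ j = j' := by
      intro j j'
      unfold lreg
      omega
    match j with
    | 0 =>
      simp [baseLim, h3, treg_ne_lreg, hlen, h2]
      ring
    | 1 => simp [baseLim, h3, treg_ne_lreg, h1]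
    | 2 => simp [baseLim, h3, treg_ne_lreg, h2]
    | j + 3 => simp [baseLim, h3, treg_ne_lreg, h0]
  -- Cells behind the input word are zero, so all arrays start out as zero.
  · simp [RAM.init]

/-- The base of the time bound. -/
def timeBase : ℕ := 2 ^ I.G.numBlue * (6 * (I.n + I.m) + 6)

theorem baseLim_le (j : ℕ) : baseLim I j ≤ timeBase I := by
  have h1 : 1 ≤ 2 ^ I.G.numBlue := Nat.one_le_two_pow
  have h2 : 6 * (I.n + I.m) + 6 ≤ timeBase I := Nat.le_mul_of_pos_left _ h1
  have h3 := I.length_encode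
  match j with
  | 0 => simp only [baseLim]; omega
  | 1 => simp only [baseLim]; omega
  | 2 => simp only [baseLim]; omega
  | j + 3 => simp only [baseLim]; omega

/-- The given edge costs at most one bit beyond the blue edges; that factor two is absorbed by the
constant 6 of `timeBase`. -/
theorem size_le : 2 ^ I.rank I.m ≤ timeBase I := by
  calc 2 ^ I.rank I.m ≤ 2 ^ (I.G.numBlue + 1) := Nat.pow_le_pow_right (by omega) I.rank_m_le
    _ = 2 ^ I.G.numBlue * 2 := pow_succ _ _
    _ ≤ timeBase I := Nat.mul_le_mul_left _ (by omega)

def timeDegree : ℕ := sizeCmd.depth + mainCmd.depth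

/-- The 9 counts the eight steps of the set-up and the copy of the number of codes into limit 3. -/
def timeFactor : ℕ := sizeCmd.coef + mainCmd.coef + 9

theorem run_c2eProg : ∃ t s, Run c2eProg (RAM.init I.encode) t s ∧
    (I.Yes → s.reg 0 = 1) ∧ (¬ I.Yes → s.reg 0 = 0) ∧
    t ≤ timeFactor * timeBase I ^ timeDegree := by
  obtain ⟨s1, hr1, h1⟩ := run_setupProg I
  obtain ⟨t2, s2, hr2, ht2, h2, -⟩ := sizeCmd.run_compile (lim := baseLim I) rfl 0 _ s1 h1
  set st2 := sizeCmd.exec I.encode (baseLim I) ⟨fun _ => 0, fun _ _ => 0⟩ with hst2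
  have hN : st2.var vN = 2 ^ I.rank I.m := exec_sizeCmd rfl _
  set lim := Function.update (baseLim I) 3 (2 ^ I.rank I.m) with hlim
  have h3 : Rep I.encode lim st2
      ⟨Function.update s2.reg (lreg 3) (s2.reg (vreg vN)), s2.mem⟩ := by
    refine ⟨fun x => ?_, fun j => ?_, h2.inp, h2.arr⟩
    · exact (Function.update_of_ne (vreg_ne_lreg _ _).symm _ _).trans (h2.var x)
    · by_cases hj : j = 3
      · subst hj
        simp [hlim, h2.var, hN]
      · have : lreg j ≠ lreg 3 := by
          unfold lreg
          omega
        simp [hlim, hj, this, h2.lim]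
  obtain ⟨t4, s4, hr4, ht4, h4, -⟩ := mainCmd.run_compile (lim := lim) (by simp [hlim, baseLim]) 0 _ _ h3
  refine ⟨_, s4, .seq hr1 (.seq hr2 (.seq (.copy _ _ _) hr4)), ?_, ?_, ?_⟩
  · have hreg : s4.reg 0 = (mainCmd.exec I.encode lim st2).var vAns := h4.var 0
    rw [hreg]
    exact (exec_mainCmd (lim := lim) (by simp [hlim, baseLim]) (by simp [hlim, baseLim])
      (by simp [hlim]) (fun i => by rw [hst2, Cmd.exec_arr _ rfl])
      (by rw [hst2, Cmd.exec_var _ rfl])).1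
  · have hreg : s4.reg 0 = (mainCmd.exec I.encode lim st2).var vAns := h4.var 0
    rw [hreg]
    exact (exec_mainCmd (lim := lim) (by simp [hlim, baseLim]) (by simp [hlim, baseLim])
      (by simp [hlim]) (fun i => by rw [hst2, Cmd.exec_arr _ rfl])
      (by rw [hst2, Cmd.exec_var _ rfl])).2
  · have hy1 : 1 ≤ timeBase I := Nat.one_le_two_pow.trans (size_le I)
    have hlimle : ∀ j, lim j ≤ timeBase I := by
      intro j
      by_cases hj : j = 3
      · rw [hlim, hj, Function.update_self]
        exact size_le I
      · rw [hlim, Function.update_of_ne hj]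
        exact baseLim_le I j
    have hc2 := sizeCmd.cost_le (baseLim_le I) hy1
    have hc4 := mainCmd.cost_le hlimle hy1
    have hd2 : timeBase I ^ sizeCmd.depth ≤ timeBase I ^ timeDegree :=
      Nat.pow_le_pow_right hy1 (Nat.le_add_right _ _)
    have hd4 : timeBase I ^ mainCmd.depth ≤ timeBase I ^ timeDegree :=
      Nat.pow_le_pow_right hy1 (Nat.le_add_left _ _)
    have hd : 1 ≤ timeBase I ^ timeDegree := Nat.one_le_pow _ _ hy1
    have he2 := hc2.trans (Nat.mul_le_mul_left sizeCmd.coef hd2)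
    have he4 := hc4.trans (Nat.mul_le_mul_left mainCmd.coef hd4)
    rw [timeFactor, add_mul, add_mul]
    omega

end Loop

/-! ### Configurations and their classes -/

set_option linter.unusedSectionVars false

namespace ConstraintGraph

open EdgeOrientation

variable {V E : Type*} {G : ConstraintGraph V E}

/-- The orientation with given red and blue arcs. -/
def combine (R : G.RedOri) (B : G.BlueOri) : G.Ori where
  arc e := if h : G.weight e = 1 then R.arc ⟨e, h⟩
    else B.arc ⟨e, (G.weight_eq e).resolve_left h⟩
  ends_eq e := by
    split
    · exact R.ends_eq _
    · exact B.ends_eq _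

theorem combine_red (R : G.RedOri) (B : G.BlueOri) : Ori.red (combine R B) = R := by
  ext1
  funext e
  simp [Ori.red, combine, e.2]

theorem combine_blue (R : G.RedOri) (B : G.BlueOri) : Ori.blue (combine R B) = B := by
  ext1
  funext e
  simp [Ori.blue, combine, e.2]

variable [DecidableEq E]

theorem Ori.blue_flip_of_red (A : G.Ori) {j : E} (hj : G.weight j = 1) :
    Ori.blue (A.flip j) = Ori.blue A := by
  ext1
  funext e
  have : (e : E) ≠ j := by
    rintro rfl
    have := e.2
    omega
  exact flip_arc_of_ne A this

theorem Ori.red_flip_of_blue (A : G.Ori) {j : E} (hj : G.weight j = 2) :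
    Ori.red (A.flip j) = Ori.red A := by
  ext1
  funext e
  have : (e : E) ≠ j := by
    rintro rfl
    have := e.2
    omega
  exact flip_arc_of_ne A this

theorem Ori.blue_flip_of_blue (A : G.Ori) (j : G.BlueEdge) :
    Ori.blue (A.flip j) = (Ori.blue A).flip j := by
  refine eq_flip (flip_arc_self A _) fun f hf => flip_arc_of_ne A ?_
  exact fun h => hf (Subtype.ext h)

variable [Fintype E] [DecidableEq V]

theorem blue_indeg_eq_zero (B : G.BlueOri) {v : V} (hv : v ∉ G.X) : B.indeg v = 0 := by
  rw [indeg, Finset.card_eq_zero, Finset.filter_eq_empty_iff]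
  rintro e - rfl
  refine hv ⟨e, ?_⟩
  rw [← B.ends_eq e]
  exact Sym2.mem_mk_right _ _

theorem Ori.Feasible.isClass {A : G.Ori} (hA : Ori.Feasible A) :
    ClassPair.IsClass (Ori.classOf A) := by
  refine ⟨fun v => ?_, Ori.red A, fun v => ?_, fun v hv => ?_⟩
  · have := hA v
    simp only [Ori.inWeight] at this
    simp only [Ori.classOf]
    omega
  · simp only [Ori.classOf, Fin.ext_iff]
    refine ⟨fun h => ?_, fun h => ?_, fun h => ?_⟩ <;> simp at h <;> omega
  · have := hA v
    rw [Ori.inWeight, blue_indeg_eq_zero _ hv] at this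
    omega

/-- A red reversal leaves the blue arcs alone and a blue one leaves the red indegrees alone; these
are the two kinds of adjacency of classes. -/
theorem classOf_adj {A A' : G.Ori} (h : A.Adj A') :
    ClassPair.Adj (Ori.classOf A) (Ori.classOf A') := by
  obtain rfl | ⟨j, hj, hj'⟩ := h
  · exact Or.inr rfl
  obtain rfl := eq_flip hj hj'
  rcases G.weight_eq j with hw | hw
  · exact Or.inr (Ori.blue_flip_of_red A hw).symm
  · refine Or.inl ⟨?_, ?_⟩
    · simp only [Ori.classOf, Ori.red_flip_of_blue A hw]
    · change (Ori.blue A).Adj (Ori.blue (A.flip j))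
      rw [Ori.blue_flip_of_blue A ⟨j, hw⟩]
      exact adj_flip _ _

theorem Ori.Reaches.classOf {A A' : G.Ori} (h : Ori.Reaches A A') :
    ClassPair.Reaches (Ori.classOf A) (Ori.classOf A') :=
  ⟨h.1.isClass, h.2.lift Ori.classOf fun _ _ h => ⟨h.1.isClass, classOf_adj h.2⟩⟩

/-- Red arcs that realize a class give, with its blue arcs, a configuration of this class. -/
theorem classOf_eq_of_realizes {A : G.Ori} {c : G.ClassPair} (hB : Ori.blue A = c.1)
    {R : G.RedOri} (hR : Realizes R c.2) (hA : ∀ v, (Ori.red A).indeg v = R.indeg v) :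
    Ori.classOf A = c := by
  refine Prod.ext hB (funext fun v => Fin.ext ?_)
  obtain ⟨h0, h1, h2⟩ := hR.1 v
  have h := hA v
  simp only [Ori.classOf, h]
  have h3 := (c.2 v).isLt
  have h0' : (c.2 v : ℕ) = 0 → R.indeg v = 0 := fun h => h0 (Fin.ext h)
  have h1' : (c.2 v : ℕ) = 1 → R.indeg v = 1 := fun h => h1 (Fin.ext h)
  have h2' : (c.2 v : ℕ) = 2 → 2 ≤ R.indeg v := fun h => h2 (Fin.ext h)
  omega

/-- Steps between classes are lifted one at a time. A change of `d` may need many red reversals,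
which the rearrangement principle provides. -/
theorem ClassPair.Reaches.exists_ori [Fintype V] {A : G.Ori} (hA : Ori.Feasible A)
    {c : G.ClassPair} (h : ClassPair.Reaches (Ori.classOf A) c) :
    ∃ A' : G.Ori, Ori.Reaches A A' ∧ Ori.classOf A' = c := by
  obtain ⟨_, h⟩ := h
  induction h with
  | refl => exact ⟨A, .refl hA, rfl⟩
  | @tail c c' _ hstep ih =>
    obtain ⟨A', hA', rfl⟩ := ih
    obtain ⟨hc', hadj⟩ := hstep
    obtain ⟨hlow, R, hR⟩ := hc'
    rcases hadj with ⟨hd, hadj⟩ | hB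
    · obtain hB | ⟨j, hj, hj'⟩ := hadj
      · exact ⟨A', hA', Prod.ext hB hd⟩
      -- The same blue edge is reversed in the configuration. Red indegrees stay, so feasibility on
      -- `X` is the inequality of the class `c'`, and no blue arc enters any other vertex.
      · have hB := eq_flip hj hj'
        change c'.1 = (Ori.blue A').flip j at hB
        rw [← Ori.blue_flip_of_blue] at hB
        have hred := Ori.red_flip_of_blue A' j.2
        have hcl : Ori.classOf (A'.flip j) = c' := by
          refine Prod.ext hB.symm ?_
          rw [← hd]
          simp only [Ori.classOf, hred]
        refine ⟨A'.flip j, hA'.tail (fun v => ?_) (adj_flip A' _), hcl⟩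
        rw [Ori.inWeight]
        by_cases hv : v ∈ G.X
        · have := hlow ⟨v, hv⟩
          rw [← hcl] at this
          simp only [Ori.classOf] at this
          omega
        · have := hA'.feasible v
          rw [Ori.inWeight, blue_indeg_eq_zero _ hv] at this
          rw [hred]
          omega
    -- Red arcs realizing the new vector, joined with the unchanged blue arcs, form a feasible
    -- target. Reaching its in-weights with the blue arcs fixed yields its red indegrees.
    · have hcfeas : Ori.Feasible (combine R c'.1) := by
        intro v
        rw [Ori.inWeight, combine_red, combine_blue]
        by_cases hv : v ∈ G.X
        · have h1 := hlow ⟨v, hv⟩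
          have h2 := classOf_eq_of_realizes (combine_blue R c'.1) hR
            fun v => by rw [combine_red]
          have h3 : (c'.2 ⟨v, hv⟩ : ℕ) ≤ R.indeg v := by
            rw [← h2]
            simp only [Ori.classOf, combine_red]
            omega
          simp only at h1
          omega
        · have := hR.2 v hv
          omega
      have hblue : ∀ D : G.Ori, (∀ f ∈ {f | G.weight f = 2}, D.arc f = A'.arc f) →
          Ori.blue D = c'.1 := by
        intro D hD
        refine Eq.trans ?_ hB
        ext1
        funext e
        exact hD e e.2
      obtain ⟨D, hD, hDA, hDflow⟩ := hA'.exists_inflow_eq hcfeas {f | G.weight f = 2}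
        (fun f hf => (G.weight_eq f).resolve_right hf) (fun f hf => by
          have := congrArg (fun B : G.BlueOri => B.arc ⟨f, hf⟩)
            ((combine_blue R c'.1).trans hB.symm)
          exact this)
      refine ⟨D, hD, classOf_eq_of_realizes (hblue D hDA) hR fun v => ?_⟩
      have := hDflow v
      rw [← Ori.inWeight_eq_inflow, ← Ori.inWeight_eq_inflow, Ori.inWeight, Ori.inWeight,
        combine_red, combine_blue, hblue D hDA] at this
      omega

/-- A red edge that is not a loop can be reversed if and only if its head can get a surplus. -/
theorem c2e_iff_problemA {A : G.Ori} (hA : Ori.Feasible A) {e : E} (he : G.weight e = 1)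
    (hloop : A.tail e ≠ A.head e) :
    C2E A e ↔ ∃ A' : G.Ori, IsProblemASolution A (A.head e) A' := by
  constructor
  · rintro ⟨A', hA', hne⟩
    have key : ∀ C : G.Ori, Relation.ReflTransGen
        (fun B B' : G.Ori => Ori.Feasible B' ∧ B.Adj B') A C → C.arc e = A.arc e ∨
        ∃ A' : G.Ori, IsProblemASolution A (A.head e) A' := by
      intro C hC
      induction hC with
      | refl => exact Or.inl rfl
      | @tail B C hB hC ih =>
        refine ih.elim (fun hBe => ?_) Or.inr
        obtain ⟨hCf, rfl | ⟨j, hj, hj'⟩⟩ := hC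
        · exact Or.inl hBe
        by_cases hje : e = j
        · subst hje
          obtain rfl := eq_flip hj hj'
          -- Up to here `e` has kept its direction. Its head loses one unit by the reversal and
          -- still has two, so it had at least three before.
          refine Or.inr ⟨B, ⟨hA, hB⟩, ?_⟩
          have h1 := hCf (A.head e)
          have h2 := inflow_flip G.weight B e (A.head e)
          have h3 : B.head e = A.head e := by rw [head, head, hBe]
          have h4 : B.tail e = A.tail e := by rw [tail, tail, hBe]
          rw [Ori.inWeight_eq_inflow] at h1 ⊢
          rw [h3, h4, if_pos rfl, if_neg hloop, he] at h2
          omega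
        · exact Or.inl ((hj' e hje).trans hBe)
    exact (key A' hA'.2).resolve_left hne
  · rintro ⟨A', hA', h3⟩
    by_cases hne : A'.arc e = A.arc e
    · refine ⟨A'.flip e, hA'.tail (fun v => ?_) (adj_flip A' e), ?_⟩
      · have h1 := hA'.feasible v
        have h2 := inflow_flip G.weight A' e v
        have h4 : A'.head e = A.head e := by rw [head, head, hne]
        rw [Ori.inWeight_eq_inflow] at h1 h3 ⊢
        rw [he, h4] at h2
        by_cases hv : A.head e = v
        · subst hv
          simp only [if_true] at h2
          omega
        · simp only [hv, if_false] at h2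
          omega
      · rw [flip_arc_self, hne]
        exact fun h => hloop (congrArg Prod.snd h)
    · exact ⟨A', hA', hne⟩

end ConstraintGraph

/-! ### The criteria for instances and the final assembly -/

open ConstraintGraph in
theorem C2EInstance.yes_iff_class (I : C2EInstance) (he : I.G.weight I.e = 2) :
    I.Yes ↔ ∃ c : I.G.ClassPair,
      ClassPair.Reaches (Ori.classOf I.A) c ∧ c.1.arc ⟨I.e, he⟩ ≠ I.A.arc I.e := by
  constructor
  · rintro ⟨A', hA', hne⟩
    exact ⟨_, hA'.classOf, hne⟩
  · rintro ⟨c, hc, hne⟩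
    obtain ⟨A', hA', rfl⟩ := hc.exists_ori I.feasible
    exact ⟨A', hA', hne⟩

/-- Without parallel edges, an edge is determined by its arc, which is one of `n * n` pairs. -/
theorem C2EInstance.m_le_of_noParallelEdges (I : C2EInstance) (h : I.G.NoParallelEdges) :
    I.m ≤ I.n * I.n := by
  have hinj : Function.Injective I.A.arc := by
    intro f g hfg
    refine h ?_
    rw [← I.A.ends_eq f, ← I.A.ends_eq g, hfg]
  simpa using Fintype.card_le_of_injective _ hinj

theorem corollary6 :
    (∃ (P : RAM.Prog) (a : ℕ) (p q : Polynomial ℕ), ∀ I : C2EInstance,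
      ∃ (t : ℕ) (s : RAM.State), RAM.Run P (RAM.init I.encode) t s ∧
        (I.Yes → s.reg 0 = 1) ∧ (¬ I.Yes → s.reg 0 = 0) ∧
        t ≤ 2 ^ (a * I.G.numBlue) * p.eval (I.n + I.m) ∧
        (I.G.NoParallelEdges → t ≤ 2 ^ (a * I.G.numBlue) * q.eval I.n)) ∧
    (∀ (I : C2EInstance) (he : I.G.weight I.e = 2),
      I.Yes ↔ ∃ c : I.G.ClassPair,
        ConstraintGraph.ClassPair.Reaches (ConstraintGraph.Ori.classOf I.A) c ∧
          c.1.arc ⟨I.e, he⟩ ≠ I.A.arc I.e) ∧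
    (∀ I : C2EInstance, I.G.weight I.e = 1 → I.A.tail I.e ≠ I.A.head I.e →
      (I.Yes ↔ ∃ A' : I.G.Ori,
        ConstraintGraph.IsProblemASolution I.A (I.A.head I.e) A')) := by
  -- The constant in the exponent is the degree, as `timeBase` contains `2 ^ k` and is raised to
  -- that power. The second polynomial arises from the first by bounding `m` by `n * n`.
  refine ⟨⟨Loop.c2eProg, Loop.timeDegree,
    Polynomial.C Loop.timeFactor * (6 * Polynomial.X + 6) ^ Loop.timeDegree,
    Polynomial.C Loop.timeFactor *
      (6 * (Polynomial.X + Polynomial.X * Polynomial.X) + 6) ^ Loop.timeDegree,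
    fun I => ?_⟩, fun I he => I.yes_iff_class he,
    fun I he hloop => ConstraintGraph.c2e_iff_problemA I.feasible he hloop⟩
  obtain ⟨t, s, hrun, hyes, hno, ht⟩ := Loop.run_c2eProg I
  have hbound : t ≤ 2 ^ (Loop.timeDegree * I.G.numBlue) *
      (Loop.timeFactor * (6 * (I.n + I.m) + 6) ^ Loop.timeDegree) := by
    refine ht.trans (le_of_eq ?_)
    rw [Loop.timeBase, mul_pow, ← pow_mul, mul_comm I.G.numBlue]
    ring
  refine ⟨t, s, hrun, hyes, hno, ?_, fun hpar => ?_⟩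
  · simpa using hbound
  · refine hbound.trans ?_
    have hm := I.m_le_of_noParallelEdges hpar
    simp only [Polynomial.eval_mul, Polynomial.eval_C, Polynomial.eval_pow, Polynomial.eval_add,
      Polynomial.eval_X, Polynomial.eval_ofNat]
    gcongr
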